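/- For $\varepsilon>0$ let $$p_\varepsilon(x)=\frac{1}{\varepsilon^2}(x^2-1)\mathbf 1_{\{|x|>1\}},\qquad q_\varepsilon(x)=\frac{1}{\varepsilon^2}\left[2(1-x^2)\mathbf 1_{\{|x|<1\}}+(x^2-1)\mathbf 1_{\{|x|>1\}}\right],$$ and let $L_-^\varepsilon$ and $L_+^\varepsilon$ be the Friedrichs extensions on $L^2(\mathbb R)$ (real- or complex-valued functions) of the operators $-\partial_x^2+p_\varepsilon$ and $-\partial_x^2+q_\varepsilon$, initially defined on the smooth compactly supported functions. For $\alpha\in(0,+\infty]$ put $\varepsilon^\alpha=0$ if $\alpha=+\infty$. $\mathcal L(E,F)$ denotes the bounded linear operators from $E$ to $F$ with the operator norm, and $\mathcal L(E)=\mathcal L(E,E)$. Let $\alpha\in(0,+\infty]$ and $\delta>0$. There exist $\varepsilon_0\in(0,1)$ and $C>0$ such that for every $\varepsilon\in(0,\varepsilon_0)$ the operators $L_-^\varepsilon$ and $L_+^\varepsilon$ have bounded, everywhere defined inverses on $L^2(\mathbb R)$, every function in the range of $(L_+^\varepsilon)^{-1}(L_-^\varepsilon)^{-1}$ has a weak derivative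 in $L^2(\mathbb R)$, and $$\|\partial_x(L_+^\varepsilon)^{-1}(L_-^\varepsilon)^{-1}\|_{\mathcal L(L^2(\mathbb R))}\le C\varepsilon^{11/12},$$ $$\|(L_+^\varepsilon)^{-1}(L_-^\varepsilon)^{-1}\|_{\mathcal L(L^2(\mathbb R))}\le C\varepsilon^{26/15-\delta},$$ $$\|\mathbf 1_{\{|x|>1\}}(L_+^\varepsilon)^{-1}(L_-^\varepsilon)^{-1}\|_{\mathcal L(L^2(\mathbb R))}\le C\varepsilon^{7/3-\delta},$$ $$\|\mathbf 1_{\{|x|>1-\varepsilon^\alpha\}}\partial_x(L_+^\varepsilon)^{-1}(L_-^\varepsilon)^{-1}\|_{\mathcal L(L^2(\mathbb R),L^\infty(\mathbb R))}\le C\varepsilon^{\min(4/3,\,1/3+3\alpha/2)-\delta},$$ $$\|\mathbf 1_{\{|x|>1-\varepsilon^\alpha\}}(L_+^\varepsilon)^{-1}(L_-^\varepsilon)^{-1}\|_{\mathcal L(L^2(\mathbb R),L^\infty(\mathbb R))}\le C\varepsilon^{\min(2,\,1+3\alpha/2)-\delta}.$$ -/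

import Mathlib

open MeasureTheory Filter Topology Set
open scoped ENNReal ContDiff InnerProductSpace

namespace ThomasFermi

/-! ### The Friedrichs extension of a nonnegative operator -/

section Friedrichs

variable {𝕜 : Type*} [RCLike 𝕜] {H : Type*} [NormedAddCommGroup H] [InnerProductSpace 𝕜 H]

/-- The quadratic form `u ↦ Re ⟨T u, u⟩` of an operator `T`. -/
noncomputable def quadForm (T : H →ₗ.[𝕜] H) (u : T.domain) : ℝ :=
  RCLike.re ⟪T u, (u : H)⟫_𝕜

/-- `T` is nonnegative: `0 ≤ Re ⟨T u, u⟩` for all `u` in its domain. -/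
def IsNonneg (T : H →ₗ.[𝕜] H) : Prop := ∀ u : T.domain, 0 ≤ quadForm T u

lemma quadForm_add_le {T : H →ₗ.[𝕜] H} (hT : IsNonneg T) (u v : T.domain) :
    quadForm T (u + v) ≤ 2 * quadForm T u + 2 * quadForm T v := by
  have h := hT (u - v)
  simp only [quadForm, LinearPMap.map_sub, LinearPMap.map_add, Submodule.coe_sub, Submodule.coe_add,
    inner_sub_left, inner_sub_right, inner_add_left, inner_add_right, map_add, map_sub] at h ⊢
  linarith

lemma quadForm_smul (T : H →ₗ.[𝕜] H) (c : 𝕜) (u : T.domain) :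
    quadForm T (c • u) = ‖c‖ ^ 2 * quadForm T u := by
  simp only [quadForm, LinearPMap.map_smul, Submodule.coe_smul, inner_smul_left, inner_smul_right]
  rw [← mul_assoc, RCLike.mul_conj, ← RCLike.ofReal_pow,
    RCLike.re_ofReal_mul]

/-- The form domain of a nonnegative operator `T`, that is, the domain of the closure of its
quadratic form: all limits in `H` of sequences in the domain of `T` that are Cauchy sequences for
the quadratic form. -/
def formDomain (T : H →ₗ.[𝕜] H) (hT : IsNonneg T) : Submodule 𝕜 H where
  carrier := {u | ∃ s : ℕ → T.domain, Tendsto (fun n => (s n : H)) atTop (𝓝 u) ∧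
    Tendsto (fun p : ℕ × ℕ => quadForm T (s p.1 - s p.2)) atTop (𝓝 0)}
  zero_mem' := ⟨fun _ => 0, by simp, by simp [quadForm]⟩
  add_mem' := by
    rintro u v ⟨s, hs, hs'⟩ ⟨t, ht, ht'⟩
    refine ⟨fun n => s n + t n, by simpa using hs.add ht, ?_⟩
    have hlim := (hs'.const_mul 2).add (ht'.const_mul 2)
    simp only [mul_zero, add_zero] at hlim
    refine squeeze_zero (fun p => hT _) (fun p => ?_) hlim
    rw [add_sub_add_comm]
    exact quadForm_add_le hT _ _
  smul_mem' := by
    rintro c u ⟨s, hs, hs'⟩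
    refine ⟨fun n => c • s n, by simpa using hs.const_smul c, ?_⟩
    simp only [← smul_sub, quadForm_smul]
    simpa using hs'.const_mul (‖c‖ ^ 2)

/-- The Friedrichs extension of a densely defined symmetric nonnegative operator `T`:
the restriction of the adjoint of `T` to the vectors of its domain that lie in the form domain. -/
noncomputable def friedrichsExtension [CompleteSpace H] (T : H →ₗ.[𝕜] H) (hT : IsNonneg T) :
    H →ₗ.[𝕜] H :=
  T.adjoint.domRestrict (formDomain T hT)

/-- `G` is the bounded, everywhere defined inverse of the operator `L`. -/
def IsBoundedInverse (L : H →ₗ.[𝕜] H) (G : H →L[𝕜] H) : Prop :=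
  (∀ f : H, ∃ h : G f ∈ L.domain, L ⟨G f, h⟩ = f) ∧ ∀ u : L.domain, G (L u) = u

end Friedrichs

/-! ### Schrödinger operators on the line -/

section Schrodinger

variable (𝕜 : Type*) [RCLike 𝕜]

/-- The Hilbert space `L²(ℝ)`. -/
abbrev L2 : Type _ := Lp 𝕜 2 (volume : Measure ℝ)

/-- The space of smooth compactly supported functions on the line. -/
def testFunctions : Submodule 𝕜 (ℝ → 𝕜) where
  carrier := {φ | ContDiff ℝ ∞ φ ∧ HasCompactSupport φ}
  zero_mem' := ⟨contDiff_const, HasCompactSupport.zero⟩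
  add_mem' := fun hf hg => ⟨hf.1.add hg.1, hf.2.add hg.2⟩
  smul_mem' := fun c _ hf => ⟨contDiff_const.smul hf.1, hf.2.smul_left (f := fun _ => c)⟩

variable {𝕜}

/-- The function `-φ'' + V φ`. -/
noncomputable def schrodingerFun (V : C(ℝ, ℝ)) (φ : ℝ → 𝕜) (x : ℝ) : 𝕜 :=
  -deriv (deriv φ) x + (V x : 𝕜) * φ x

lemma testFunctions.memLp (φ : testFunctions 𝕜) : MemLp (φ : ℝ → 𝕜) 2 volume :=
  φ.2.1.continuous.memLp_of_hasCompactSupport φ.2.2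

lemma testFunctions.contDiff_deriv (φ : testFunctions 𝕜) : ContDiff ℝ ∞ (deriv (φ : ℝ → 𝕜)) :=
  (contDiff_infty_iff_deriv.1 φ.2.1).2

lemma testFunctions.contDiff_deriv2 (φ : testFunctions 𝕜) :
    ContDiff ℝ ∞ (deriv (deriv (φ : ℝ → 𝕜))) :=
  (contDiff_infty_iff_deriv.1 (testFunctions.contDiff_deriv φ)).2

lemma schrodingerFun_continuous (V : C(ℝ, ℝ)) (φ : testFunctions 𝕜) :
    Continuous (schrodingerFun V (φ : ℝ → 𝕜)) :=
  (testFunctions.contDiff_deriv2 φ).continuous.neg.add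
    ((RCLike.continuous_ofReal.comp V.continuous).mul φ.2.1.continuous)

lemma schrodingerFun_hasCompactSupport (V : C(ℝ, ℝ)) (φ : testFunctions 𝕜) :
    HasCompactSupport (schrodingerFun V (φ : ℝ → 𝕜)) :=
  φ.2.2.deriv.deriv.neg.add (φ.2.2.mul_left (f := fun x => (V x : 𝕜)))

lemma schrodingerFun_memLp (V : C(ℝ, ℝ)) (φ : testFunctions 𝕜) :
    MemLp (schrodingerFun V (φ : ℝ → 𝕜)) 2 volume :=
  (schrodingerFun_continuous V φ).memLp_of_hasCompactSupport (schrodingerFun_hasCompactSupport V φ)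

variable (𝕜)

/-- The embedding of the test functions into `L²(ℝ)`. -/
noncomputable def testToL2 : testFunctions 𝕜 →ₗ[𝕜] L2 𝕜 where
  toFun φ := (testFunctions.memLp φ).toLp _
  map_add' φ ψ := MemLp.toLp_add (testFunctions.memLp φ) (testFunctions.memLp ψ)
  map_smul' c φ := MemLp.toLp_const_smul c (testFunctions.memLp φ)

lemma testToL2_injective : Function.Injective (testToL2 𝕜) := by
  intro φ ψ h
  have h' := (MemLp.toLp_eq_toLp_iff (testFunctions.memLp φ) (testFunctions.memLp ψ)).1 h
  exact Subtype.ext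
    ((Continuous.ae_eq_iff_eq volume φ.2.1.continuous ψ.2.1.continuous).1 h')

/-- The map `φ ↦ -φ'' + V φ` from the test functions to `L²(ℝ)`. -/
noncomputable def schrodingerTest (V : C(ℝ, ℝ)) : testFunctions 𝕜 →ₗ[𝕜] L2 𝕜 where
  toFun φ := (schrodingerFun_memLp V φ).toLp _
  map_add' φ ψ := by
    rw [← MemLp.toLp_add, MemLp.toLp_eq_toLp_iff]
    refine Eventually.of_forall fun x => ?_
    have h1 : deriv (((φ + ψ : testFunctions 𝕜)) : ℝ → 𝕜) =
        fun y => deriv (φ : ℝ → 𝕜) y + deriv (ψ : ℝ → 𝕜) y := by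
      funext y
      exact deriv_add (φ.2.1.differentiable (by simp) y) (ψ.2.1.differentiable (by simp) y)
    have h2 : deriv (fun y => deriv (φ : ℝ → 𝕜) y + deriv (ψ : ℝ → 𝕜) y) x =
        deriv (deriv (φ : ℝ → 𝕜)) x + deriv (deriv (ψ : ℝ → 𝕜)) x :=
      deriv_add ((testFunctions.contDiff_deriv φ).differentiable (by simp) x)
        ((testFunctions.contDiff_deriv ψ).differentiable (by simp) x)
    rw [Pi.add_apply, schrodingerFun, h1, h2]
    simp only [schrodingerFun, Pi.add_apply, Submodule.coe_add]
    ring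
  map_smul' c φ := by
    rw [RingHom.id_apply, ← MemLp.toLp_const_smul, MemLp.toLp_eq_toLp_iff]
    refine Eventually.of_forall fun x => ?_
    have h1 : deriv (((c • φ : testFunctions 𝕜)) : ℝ → 𝕜) =
        fun y => c * deriv (φ : ℝ → 𝕜) y := by
      funext y
      exact deriv_const_mul c (φ.2.1.differentiable (by simp) y)
    have h2 : deriv (fun y => c * deriv (φ : ℝ → 𝕜) y) x = c * deriv (deriv (φ : ℝ → 𝕜)) x :=
      deriv_const_mul c ((testFunctions.contDiff_deriv φ).differentiable (by simp) x)
    rw [Pi.smul_apply, schrodingerFun, h1, h2]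
    simp only [schrodingerFun, Pi.smul_apply, Submodule.coe_smul, smul_eq_mul]
    ring

/-- The operator `-∂ₓ² + V` on `L²(ℝ)` with the smooth compactly supported functions as domain. -/
noncomputable def schrodingerMin (V : C(ℝ, ℝ)) : L2 𝕜 →ₗ.[𝕜] L2 𝕜 where
  domain := LinearMap.range (testToL2 𝕜)
  toFun := (schrodingerTest 𝕜 V).comp
    (LinearEquiv.ofInjective (testToL2 𝕜) (testToL2_injective 𝕜)).symm.toLinearMap

lemma schrodingerMin_isNonneg (V : C(ℝ, ℝ)) (hV : ∀ x, 0 ≤ V x) :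
    IsNonneg (schrodingerMin 𝕜 V) := by
  rintro ⟨_, φ, rfl⟩
  have hval : schrodingerMin 𝕜 V ⟨testToL2 𝕜 φ, φ, rfl⟩ = schrodingerTest 𝕜 V φ := by
    change schrodingerTest 𝕜 V ((LinearEquiv.ofInjective (testToL2 𝕜)
      (testToL2_injective 𝕜)).symm ⟨testToL2 𝕜 φ, φ, rfl⟩) = _
    congr 1
    rw [LinearEquiv.symm_apply_eq]
    rfl
  have hd : ∀ x, HasDerivAt (φ : ℝ → 𝕜) (deriv (φ : ℝ → 𝕜) x) x := fun x =>
    (φ.2.1.differentiable (by simp) x).hasDerivAt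
  have hd2 : ∀ x, HasDerivAt (deriv (φ : ℝ → 𝕜)) (deriv (deriv (φ : ℝ → 𝕜)) x) x := fun x =>
    ((testFunctions.contDiff_deriv φ).differentiable (by simp) x).hasDerivAt
  have hc0 := φ.2.1.continuous
  have hc1 := (testFunctions.contDiff_deriv φ).continuous
  have hc2 := (testFunctions.contDiff_deriv2 φ).continuous
  have hstar : HasCompactSupport (fun x => star ((φ : ℝ → 𝕜) x)) :=
    φ.2.2.comp_left (g := fun z : 𝕜 => star z) (star_zero 𝕜)
  have hstar1 : HasCompactSupport (fun x => star (deriv (φ : ℝ → 𝕜) x)) :=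
    φ.2.2.deriv.comp_left (g := fun z : 𝕜 => star z) (star_zero 𝕜)
  have hparts : ∫ x, star ((φ : ℝ → 𝕜) x) * deriv (deriv (φ : ℝ → 𝕜)) x =
      -∫ x, star (deriv (φ : ℝ → 𝕜) x) * deriv (φ : ℝ → 𝕜) x := by
    refine integral_mul_deriv_eq_deriv_mul_of_integrable (fun x _ => (hd x).star)
      (fun x _ => hd2 x) ?_ ?_ ?_
    · exact (hc0.star.mul hc2).integrable_of_hasCompactSupport hstar.mul_right
    · exact (hc1.star.mul hc1).integrable_of_hasCompactSupport hstar1.mul_right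
    · exact (hc0.star.mul hc1).integrable_of_hasCompactSupport hstar.mul_right
  have hI1 : Integrable (fun x => star ((φ : ℝ → 𝕜) x) * deriv (deriv (φ : ℝ → 𝕜)) x) :=
    (hc0.star.mul hc2).integrable_of_hasCompactSupport hstar.mul_right
  have hcV : Continuous fun x => ((V x : ℝ) : 𝕜) := RCLike.continuous_ofReal.comp V.continuous
  have hI2 : Integrable (fun x => star ((φ : ℝ → 𝕜) x) * ((V x : 𝕜) * (φ : ℝ → 𝕜) x)) :=
    (hc0.star.mul (hcV.mul hc0)).integrable_of_hasCompactSupport hstar.mul_right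
  have hinner : ⟪testToL2 𝕜 φ, schrodingerTest 𝕜 V φ⟫_𝕜 =
      ((∫ x, ‖deriv (φ : ℝ → 𝕜) x‖ ^ 2 : ℝ) : 𝕜) +
        ((∫ x, V x * ‖(φ : ℝ → 𝕜) x‖ ^ 2 : ℝ) : 𝕜) := by
    rw [L2.inner_def]
    have hae : (fun x => ⟪(testToL2 𝕜 φ : ℝ → 𝕜) x, (schrodingerTest 𝕜 V φ : ℝ → 𝕜) x⟫_𝕜)
        =ᵐ[volume] fun x => -(star ((φ : ℝ → 𝕜) x) * deriv (deriv (φ : ℝ → 𝕜)) x) +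
          star ((φ : ℝ → 𝕜) x) * ((V x : 𝕜) * (φ : ℝ → 𝕜) x) := by
      filter_upwards [(testFunctions.memLp φ).coeFn_toLp, (schrodingerFun_memLp V φ).coeFn_toLp]
        with x h1 h2
      have h1' : (testToL2 𝕜 φ : ℝ → 𝕜) x = (φ : ℝ → 𝕜) x := h1
      have h2' : (schrodingerTest 𝕜 V φ : ℝ → 𝕜) x = schrodingerFun V (φ : ℝ → 𝕜) x := h2
      rw [h1', h2', RCLike.inner_apply, schrodingerFun, starRingEnd_apply]
      ring
    have hI1n : Integrable (fun x => -(star ((φ : ℝ → 𝕜) x) * deriv (deriv (φ : ℝ → 𝕜)) x)) :=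
      hI1.neg
    rw [integral_congr_ae hae, integral_add hI1n hI2, integral_neg, hparts, neg_neg,
      ← integral_ofReal, ← integral_ofReal]
    congr 1
    · refine integral_congr_ae (Eventually.of_forall fun x => ?_)
      change star _ * _ = _
      rw [← starRingEnd_apply, RCLike.conj_mul]
      push_cast
      rfl
    · refine integral_congr_ae (Eventually.of_forall fun x => ?_)
      change star _ * _ = _
      rw [mul_left_comm, ← starRingEnd_apply, RCLike.conj_mul]
      push_cast
      rfl
  rw [quadForm, hval, inner_re_symm, hinner, ← RCLike.ofReal_add, RCLike.ofReal_re]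
  exact add_nonneg (integral_nonneg fun x => by positivity)
    (integral_nonneg fun x => mul_nonneg (hV x) (by positivity))

/-- The Friedrichs extension of `-∂ₓ² + V` on `L²(ℝ)`. -/
noncomputable def schrodinger (V : C(ℝ, ℝ)) (hV : ∀ x, 0 ≤ V x) : L2 𝕜 →ₗ.[𝕜] L2 𝕜 :=
  friedrichsExtension (schrodingerMin 𝕜 V) (schrodingerMin_isNonneg 𝕜 V hV)

end Schrodinger

/-! ### The potentials `p_ε`, `q_ε` and the operators `L_-^ε`, `L_+^ε` -/

/-- `p_ε(x) = ε⁻² (x² - 1) 1_{|x| > 1}`. -/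
noncomputable def pFun (ε x : ℝ) : ℝ :=
  1 / ε ^ 2 * {y : ℝ | 1 < |y|}.indicator (fun y => y ^ 2 - 1) x

/-- `q_ε(x) = ε⁻² (2 (1 - x²) 1_{|x| < 1} + (x² - 1) 1_{|x| > 1})`. -/
noncomputable def qFun (ε x : ℝ) : ℝ :=
  1 / ε ^ 2 * ({y : ℝ | |y| < 1}.indicator (fun y => 2 * (1 - y ^ 2)) x +
    {y : ℝ | 1 < |y|}.indicator (fun y => y ^ 2 - 1) x)

lemma indicator_outer_eq (x : ℝ) :
    {y : ℝ | 1 < |y|}.indicator (fun y => y ^ 2 - 1) x = max (x ^ 2 - 1) 0 := by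
  by_cases h : 1 < |x|
  · rw [indicator_of_mem (show x ∈ {y : ℝ | 1 < |y|} from h), max_eq_left]
    nlinarith [sq_abs x]
  · rw [indicator_of_notMem (show x ∉ {y : ℝ | 1 < |y|} from h), max_eq_right]
    nlinarith [sq_abs x, abs_nonneg x]

lemma indicator_inner_eq (x : ℝ) :
    {y : ℝ | |y| < 1}.indicator (fun y => 2 * (1 - y ^ 2)) x = max (2 * (1 - x ^ 2)) 0 := by
  by_cases h : |x| < 1
  · rw [indicator_of_mem (show x ∈ {y : ℝ | |y| < 1} from h), max_eq_left]
    nlinarith [sq_abs x, abs_nonneg x]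
  · rw [indicator_of_notMem (show x ∉ {y : ℝ | |y| < 1} from h), max_eq_right]
    nlinarith [sq_abs x, abs_nonneg x]

lemma pFun_continuous (ε : ℝ) : Continuous (pFun ε) := by
  unfold pFun
  simp only [indicator_outer_eq]
  fun_prop

lemma qFun_continuous (ε : ℝ) : Continuous (qFun ε) := by
  unfold qFun
  simp only [indicator_outer_eq, indicator_inner_eq]
  fun_prop

lemma pFun_nonneg (ε x : ℝ) : 0 ≤ pFun ε x := by
  unfold pFun
  rw [indicator_outer_eq]
  positivity

lemma qFun_nonneg (ε x : ℝ) : 0 ≤ qFun ε x := by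
  unfold qFun
  rw [indicator_outer_eq, indicator_inner_eq]
  positivity

/-- `L_-^ε`, the Friedrichs extension of `-∂ₓ² + p_ε` on `L²(ℝ)`. -/
noncomputable def Lminus (𝕜 : Type*) [RCLike 𝕜] (ε : ℝ) : L2 𝕜 →ₗ.[𝕜] L2 𝕜 :=
  schrodinger 𝕜 ⟨pFun ε, pFun_continuous ε⟩ (pFun_nonneg ε)

/-- `L_+^ε`, the Friedrichs extension of `-∂ₓ² + q_ε` on `L²(ℝ)`. -/
noncomputable def Lplus (𝕜 : Type*) [RCLike 𝕜] (ε : ℝ) : L2 𝕜 →ₗ.[𝕜] L2 𝕜 :=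
  schrodinger 𝕜 ⟨qFun ε, qFun_continuous ε⟩ (qFun_nonneg ε)

/-! ### Weak derivatives, operator norms, localization -/

/-- `g` is the weak derivative `∂ₓ u`. -/
def IsWeakDeriv {𝕜 : Type*} [RCLike 𝕜] (u g : L2 𝕜) : Prop :=
  ∀ φ ∈ testFunctions 𝕜, ∫ x, u x * deriv φ x = -∫ x, g x * φ x

/-- The norm in `𝓛(L²(ℝ), Lᵖ(ℝ))` of an operator `T` that maps elements of `L²(ℝ)` to measurable
functions; it is `∞` if `T` is not bounded from `L²(ℝ)` to `Lᵖ(ℝ)`. -/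
noncomputable def opNorm {𝕜 : Type*} [RCLike 𝕜] (p : ℝ≥0∞) (T : L2 𝕜 → ℝ → 𝕜) : ℝ≥0∞ :=
  ⨆ (f : L2 𝕜) (_ : f ≠ 0), eLpNorm (T f) p volume / ‖f‖ₑ

/-- `ε ^ α` for an exponent `α ∈ [0, ∞]`, with the convention `ε ^ ∞ = 0`. -/
noncomputable def extPow (ε : ℝ) (α : ℝ≥0∞) : ℝ :=
  if α = ⊤ then 0 else ε ^ α.toReal

/-- The set `{|x| > 1 - ε ^ α}`. -/
def edgeSet (ε : ℝ) (α : ℝ≥0∞) : Set ℝ := {x | 1 - extPow ε α < |x|}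

end ThomasFermi

/-!
Write `ε = e³`, so that `ε^{2/3} = e²` is the width of the boundary layers at the turning points
`x = ±1`, and let `t = (x² - 1) / e²` be the scaled distance to them. For `f` in `L²(ℝ)` put
`v = (L_-^ε)⁻¹ f` and `w = (L_+^ε)⁻¹ v`. The estimates follow from bounds on `v` and `w` that are
uniform in `ε` and have no loss in the exponents.

*Inverses.* The form of `-∂ₓ² + V` is bounded below by `1 / 4` on test functions as soon as
`V ≥ (x² - 1) / 4` (`coercive_of_le`). Completing the test functions for the form gives a Hilbert
space, realized as the closure of the pairs `(φ', √V φ)` in `L² × L²`, together with a bounded map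
`j` to `L²(ℝ)`; the inverse of the Friedrichs extension is `j j†`
(`isBoundedInverse_friedrichsExtension`, `exists_isBoundedInverse`). For continuous data the
solutions are classical (`exists_classical_solution`, from the lemma of du Bois-Reymond). Since
pointwise bounds pass to limits, it is enough to treat test functions `f`, and a real linear
functional of norm one reduces all pointwise bounds to real-valued solutions.

*The bound `|v| ≲ ‖f‖ (ε^{2/3} + (1 - x²)₊)`* (`norm_le_of_pFun_equation`). On `[-1, 1]` one has
`v'' = -f`, so `v'` is bounded there. On `[1, ∞)`, where `p_ε' ≥ 2 ε⁻²`, the multiplier `v'` gives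
`‖v‖_{L²(1,∞)} ≲ ε ‖f‖`, and the multiplier `v` then gives `|v| ≲ ε^{2/3} ‖f‖`.

*The bounds on `w`* (`norm_le_of_qFun_equation`). The maximum principle with the barriers
`ε² (102 + 1 / (1 + t²))` and `ε² / (1 + t)` gives `|w| ≲ ε² ‖f‖` everywhere and
`|w| ≲ ε² ‖f‖ / (1 + t)` for `|x| > 1`; the square of the last function has integral of order
`ε^{4 + 2/3}`. By the equation, `|w''| ≲ ε^{2/3} + (1 - x²)₊`, and Landau's inequality yields the
bound on `w'` near the edges (`norm_deriv_le_of_qFun_equation`). Finally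
`‖w'‖² ≤ ‖v‖ ‖w‖ ≲ ε² ‖f‖²` by the energy identity.
-/

namespace ThomasFermi

/-! ### Friedrichs extensions and representations of the form -/

section AbstractFriedrichs

variable {𝕜 : Type*} [RCLike 𝕜] {H : Type*} [NormedAddCommGroup H] [InnerProductSpace 𝕜 H]
  {E : Type*} [NormedAddCommGroup E] [InnerProductSpace 𝕜 E]

/-- If `e` represents the form of `T` in a Hilbert space `E` and `j` is the induced map to `H`, the
identity `⟨T x, y⟩ = ⟨e x, e y⟩` extends by density from vectors `y` of the domain to all of `E`. -/
lemma inner_apply_eq_inner_of_denseRange {T : H →ₗ.[𝕜] H} {e : T.domain →ₗ[𝕜] E}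
    (he : DenseRange e) (hform : ∀ x y : T.domain, ⟪e x, e y⟫_𝕜 = ⟪T x, (y : H)⟫_𝕜)
    {j : E →L[𝕜] H} (hj : ∀ x, j (e x) = x) (x : T.domain) (k : E) :
    ⟪T x, j k⟫_𝕜 = ⟪e x, k⟫_𝕜 := by
  refine he.induction_on (p := fun k => ⟪T x, j k⟫_𝕜 = ⟪e x, k⟫_𝕜) k
    (isClosed_eq (by fun_prop) (by fun_prop)) fun y => ?_
  rw [hj, hform]

lemma quadForm_eq_norm_sq {T : H →ₗ.[𝕜] H} {e : T.domain →ₗ[𝕜] E}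
    (hform : ∀ x y : T.domain, ⟪e x, e y⟫_𝕜 = ⟪T x, (y : H)⟫_𝕜) (x : T.domain) :
    quadForm T x = ‖e x‖ ^ 2 := by
  rw [quadForm, ← hform, ← inner_self_eq_norm_sq (𝕜 := 𝕜)]

variable [CompleteSpace H] [CompleteSpace E]

/-- If the form of `T` is represented in a Hilbert space `E`, with induced bounded map `j : E → H`,
then the bounded inverse of the Friedrichs extension of `T` is `j j†`. -/
theorem isBoundedInverse_friedrichsExtension {T : H →ₗ.[𝕜] H} (hT : IsNonneg T)
    (hdense : Dense (T.domain : Set H)) {e : T.domain →ₗ[𝕜] E} (he : DenseRange e)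
    (hform : ∀ x y : T.domain, ⟪e x, e y⟫_𝕜 = ⟪T x, (y : H)⟫_𝕜)
    {j : E →L[𝕜] H} (hj : ∀ x, j (e x) = x) :
    IsBoundedInverse (friedrichsExtension T hT) (j ∘L j.adjoint) := by
  have key := inner_apply_eq_inner_of_denseRange he hform hj
  constructor
  · intro f
    have hadj : ∀ x : T.domain, ⟪f, (x : H)⟫_𝕜 = ⟪j (j.adjoint f), T x⟫_𝕜 := by
      intro x
      rw [← inner_conj_symm (j (j.adjoint f)), key, inner_conj_symm,
        ContinuousLinearMap.adjoint_inner_left, hj]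
    have hdom : j (j.adjoint f) ∈ T.adjoint.domain :=
      LinearPMap.mem_adjoint_domain_of_exists _ ⟨f, hadj⟩
    have hform' : j (j.adjoint f) ∈ formDomain T hT := by
      obtain ⟨s, hs, hlim⟩ := mem_closure_iff_seq_limit.1 (he (j.adjoint f))
      choose t ht using hs
      have hlim' : Tendsto (fun n => e (t n)) atTop (𝓝 (j.adjoint f)) := by
        simpa only [ht] using hlim
      refine ⟨t, ?_, ?_⟩
      · have := (j.continuous.tendsto _).comp hlim'
        simpa only [Function.comp_def, hj] using this
      · simp only [quadForm_eq_norm_sq hform, map_sub]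
        have h1 : Tendsto (fun p : ℕ × ℕ => e (t p.1) - e (t p.2)) (atTop ×ˢ atTop)
            (𝓝 (j.adjoint f - j.adjoint f)) :=
          (hlim'.comp tendsto_fst).sub (hlim'.comp tendsto_snd)
        rw [prod_atTop_atTop_eq, sub_self] at h1
        simpa using (h1.norm.pow 2)
    refine ⟨⟨hform', hdom⟩, ?_⟩
    exact (LinearPMap.domRestrict_apply (y := ⟨_, hdom⟩) rfl).trans
      (LinearPMap.adjoint_apply_eq hdense _ hadj)
  · rintro ⟨u, ⟨t, ht, hcauchy⟩, hu⟩
    have happ : friedrichsExtension T hT ⟨u, ⟨t, ht, hcauchy⟩, hu⟩ = T.adjoint ⟨u, hu⟩ :=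
      LinearPMap.domRestrict_apply (y := ⟨u, hu⟩) rfl
    rw [happ]
    have hfa := LinearPMap.adjoint_isFormalAdjoint hdense ⟨u, hu⟩
    set g := T.adjoint ⟨u, hu⟩ with hg
    have hc : CauchySeq fun n => e (t n) := by
      rw [cauchySeq_iff_tendsto_dist_atTop_0]
      simp only [quadForm_eq_norm_sq hform, map_sub] at hcauchy
      have := (Real.continuous_sqrt.tendsto 0).comp hcauchy
      simpa [Function.comp_def, Real.sqrt_sq, dist_eq_norm] using this
    obtain ⟨k, hk⟩ := cauchySeq_tendsto_of_complete hc
    have hjk : j k = u := by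
      refine tendsto_nhds_unique ((j.continuous.tendsto k).comp hk) ?_
      simpa only [Function.comp_def, hj] using ht
    have hkg : k = j.adjoint g := by
      refine Dense.eq_of_inner_right 𝕜 (show Dense (Set.range e) from he) ?_
      rintro _ ⟨x, rfl⟩
      rw [← key, hjk, ContinuousLinearMap.adjoint_inner_right, hj, ← inner_conj_symm, ← hfa x,
        inner_conj_symm]
    change j (j.adjoint g) = u
    rw [← hkg, hjk]

end AbstractFriedrichs

/-! ### The form space of a Schrödinger operator -/

section FormSpace

lemma norm_toLp_sq {𝕜 : Type*} [RCLike 𝕜] {h : ℝ → 𝕜} (hh : MemLp h 2 volume) :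
    ‖hh.toLp h‖ ^ 2 = ∫ x, ‖h x‖ ^ 2 := by
  have h1 : ((‖hh.toLp h‖ ^ 2 : ℝ) : 𝕜) = ((∫ x, ‖h x‖ ^ 2 : ℝ) : 𝕜) := by
    rw [RCLike.ofReal_pow, ← inner_self_eq_norm_sq_to_K (𝕜 := 𝕜), L2.inner_def, ← integral_ofReal]
    refine integral_congr_ae ?_
    filter_upwards [hh.coeFn_toLp] with x hx
    rw [hx, inner_self_eq_norm_sq_to_K, RCLike.ofReal_pow]
  exact_mod_cast h1

variable (𝕜 : Type*) [RCLike 𝕜]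

/-- Differentiation of test functions. -/
noncomputable def derivTest : testFunctions 𝕜 →ₗ[𝕜] testFunctions 𝕜 where
  toFun φ := ⟨deriv (φ : ℝ → 𝕜), testFunctions.contDiff_deriv φ, φ.2.2.deriv⟩
  map_add' φ ψ := by
    refine Subtype.ext (funext fun y => ?_)
    exact deriv_add (φ.2.1.differentiable (by simp) y) (ψ.2.1.differentiable (by simp) y)
  map_smul' c φ := by
    refine Subtype.ext (funext fun y => ?_)
    exact deriv_const_mul c (φ.2.1.differentiable (by simp) y)

lemma testFunctions.memLp_mul (W : C(ℝ, ℝ)) (φ : testFunctions 𝕜) :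
    MemLp (fun x => (W x : 𝕜) * (φ : ℝ → 𝕜) x) 2 volume :=
  ((RCLike.continuous_ofReal.comp W.continuous).mul
    φ.2.1.continuous).memLp_of_hasCompactSupport (φ.2.2.mul_left (f := fun x => (W x : 𝕜)))

/-- Multiplication of test functions by a continuous real function, as a map to `L²(ℝ)`. -/
noncomputable def mulTest (W : C(ℝ, ℝ)) : testFunctions 𝕜 →ₗ[𝕜] L2 𝕜 where
  toFun φ := (testFunctions.memLp_mul 𝕜 W φ).toLp _
  map_add' φ ψ := by
    rw [← MemLp.toLp_add, MemLp.toLp_eq_toLp_iff]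
    refine Eventually.of_forall fun x => ?_
    simp only [Pi.add_apply, Submodule.coe_add, mul_add]
  map_smul' c φ := by
    rw [RingHom.id_apply, ← MemLp.toLp_const_smul, MemLp.toLp_eq_toLp_iff]
    refine Eventually.of_forall fun x => ?_
    simp only [Pi.smul_apply, Submodule.coe_smul, smul_eq_mul]
    ring

/-- The square root of a potential. -/
noncomputable def sqrtPot (V : C(ℝ, ℝ)) : C(ℝ, ℝ) :=
  ⟨fun x => √(V x), V.continuous.sqrt⟩

/-- The map `φ ↦ (φ', √V φ)`, for which the inner product of the images is the form
of `-∂ₓ² + V`. -/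
noncomputable def formEmbedding (V : C(ℝ, ℝ)) :
    testFunctions 𝕜 →ₗ[𝕜] WithLp 2 (L2 𝕜 × L2 𝕜) :=
  (WithLp.linearEquiv 2 𝕜 (L2 𝕜 × L2 𝕜)).symm.toLinearMap ∘ₗ
    ((testToL2 𝕜 ∘ₗ derivTest 𝕜).prod (mulTest 𝕜 (sqrtPot V)))

/-- The Hilbert space completion of the test functions for the form of `-∂ₓ² + V`, realized as
the closure of the pairs `(φ', √V φ)` in `L² × L²`. -/
noncomputable abbrev formSpace (V : C(ℝ, ℝ)) : Submodule 𝕜 (WithLp 2 (L2 𝕜 × L2 𝕜)) :=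
  (LinearMap.range (formEmbedding 𝕜 V)).topologicalClosure

/-- The canonical map from the test functions to the form space. -/
noncomputable def toFormSpace (V : C(ℝ, ℝ)) : testFunctions 𝕜 →ₗ[𝕜] formSpace 𝕜 V :=
  (formEmbedding 𝕜 V).codRestrict _ fun φ =>
    Submodule.le_topologicalClosure _ (LinearMap.mem_range_self _ φ)

lemma denseRange_toFormSpace (V : C(ℝ, ℝ)) : DenseRange (toFormSpace 𝕜 V) := by
  intro k
  rw [closure_subtype]
  have := k.2
  rw [← SetLike.mem_coe, Submodule.topologicalClosure_coe] at this
  convert this using 2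
  ext y
  constructor
  · rintro ⟨_, ⟨φ, rfl⟩, rfl⟩
    exact ⟨φ, rfl⟩
  · rintro ⟨φ, rfl⟩
    exact ⟨_, ⟨φ, rfl⟩, rfl⟩

variable {𝕜}

lemma schrodingerMin_apply (V : C(ℝ, ℝ)) (φ : testFunctions 𝕜) :
    schrodingerMin 𝕜 V ⟨testToL2 𝕜 φ, φ, rfl⟩ = schrodingerTest 𝕜 V φ := by
  change schrodingerTest 𝕜 V ((LinearEquiv.ofInjective (testToL2 𝕜)
    (testToL2_injective 𝕜)).symm ⟨testToL2 𝕜 φ, φ, rfl⟩) = _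
  congr 1
  rw [LinearEquiv.symm_apply_eq]
  rfl

lemma inner_testToL2_left (φ : testFunctions 𝕜) (u : L2 𝕜) :
    ⟪testToL2 𝕜 φ, u⟫_𝕜 = ∫ x, star ((φ : ℝ → 𝕜) x) * u x := by
  rw [L2.inner_def]
  refine integral_congr_ae ?_
  filter_upwards [(testFunctions.memLp φ).coeFn_toLp] with x h1
  have h1' : (testToL2 𝕜 φ : ℝ → 𝕜) x = (φ : ℝ → 𝕜) x := h1
  rw [h1', RCLike.inner_apply, starRingEnd_apply, mul_comm]

lemma inner_mulTest_left (W : C(ℝ, ℝ)) (φ : testFunctions 𝕜) (u : L2 𝕜) :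
    ⟪mulTest 𝕜 W φ, u⟫_𝕜 = ∫ x, star ((φ : ℝ → 𝕜) x) * ((W x : 𝕜) * u x) := by
  rw [L2.inner_def]
  refine integral_congr_ae ?_
  filter_upwards [(testFunctions.memLp_mul 𝕜 W φ).coeFn_toLp] with x h1
  have h1' : (mulTest 𝕜 W φ : ℝ → 𝕜) x = (W x : 𝕜) * (φ : ℝ → 𝕜) x := h1
  rw [h1', RCLike.inner_apply, map_mul, RCLike.conj_ofReal, starRingEnd_apply]
  ring

lemma testToL2_coeFn (φ : testFunctions 𝕜) : (testToL2 𝕜 φ : ℝ → 𝕜) =ᵐ[volume] (φ : ℝ → 𝕜) :=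
  (testFunctions.memLp φ).coeFn_toLp

lemma mulTest_coeFn (W : C(ℝ, ℝ)) (φ : testFunctions 𝕜) :
    (mulTest 𝕜 W φ : ℝ → 𝕜) =ᵐ[volume] fun x => (W x : 𝕜) * (φ : ℝ → 𝕜) x :=
  (testFunctions.memLp_mul 𝕜 W φ).coeFn_toLp

lemma testFunctions.hasDerivAt (φ : testFunctions 𝕜) (x : ℝ) :
    HasDerivAt (φ : ℝ → 𝕜) ((derivTest 𝕜 φ : ℝ → 𝕜) x) x :=
  (φ.2.1.differentiable (by simp) x).hasDerivAt

lemma integral_star_deriv_mul (φ ψ : testFunctions 𝕜) :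
    ∫ x, star ((derivTest 𝕜 φ : ℝ → 𝕜) x) * (ψ : ℝ → 𝕜) x =
      -∫ x, star ((φ : ℝ → 𝕜) x) * (derivTest 𝕜 ψ : ℝ → 𝕜) x := by
  have hi : ∀ φ ψ : testFunctions 𝕜,
      Integrable (fun x => star ((φ : ℝ → 𝕜) x) * (ψ : ℝ → 𝕜) x) := fun φ ψ =>
    (φ.2.1.continuous.star.mul ψ.2.1.continuous).integrable_of_hasCompactSupport ψ.2.2.mul_left
  rw [integral_mul_deriv_eq_deriv_mul_of_integrable (u := fun x => star ((φ : ℝ → 𝕜) x))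
    (fun x _ => (testFunctions.hasDerivAt φ x).star)
    (fun x _ => testFunctions.hasDerivAt ψ x) (hi _ _) (hi _ _) (hi _ _),
    neg_neg]

/-- The form of `-∂ₓ² + V`, by integration by parts. -/
lemma inner_formEmbedding (V : C(ℝ, ℝ)) (hV : ∀ x, 0 ≤ V x) (φ ψ : testFunctions 𝕜) :
    ⟪formEmbedding 𝕜 V φ, formEmbedding 𝕜 V ψ⟫_𝕜 =
      ⟪schrodingerTest 𝕜 V φ, testToL2 𝕜 ψ⟫_𝕜 := by
  have e1 : ⟪formEmbedding 𝕜 V φ, formEmbedding 𝕜 V ψ⟫_𝕜 =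
      ⟪testToL2 𝕜 (derivTest 𝕜 φ), testToL2 𝕜 (derivTest 𝕜 ψ)⟫_𝕜 +
      ⟪mulTest 𝕜 (sqrtPot V) φ, mulTest 𝕜 (sqrtPot V) ψ⟫_𝕜 := rfl
  have hi : ∀ φ ψ : testFunctions 𝕜,
      Integrable (fun x => star ((φ : ℝ → 𝕜) x) * (ψ : ℝ → 𝕜) x) := fun φ ψ =>
    (φ.2.1.continuous.star.mul ψ.2.1.continuous).integrable_of_hasCompactSupport ψ.2.2.mul_left
  have e2 : ⟪testToL2 𝕜 (derivTest 𝕜 φ), testToL2 𝕜 (derivTest 𝕜 ψ)⟫_𝕜 =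
      ∫ x, star ((derivTest 𝕜 φ : ℝ → 𝕜) x) * (derivTest 𝕜 ψ : ℝ → 𝕜) x := by
    rw [inner_testToL2_left]
    refine integral_congr_ae ?_
    filter_upwards [testToL2_coeFn (derivTest 𝕜 ψ)] with x hx
    rw [hx]
  have e3 : ⟪mulTest 𝕜 (sqrtPot V) φ, mulTest 𝕜 (sqrtPot V) ψ⟫_𝕜 =
      ∫ x, star ((φ : ℝ → 𝕜) x) * ((V x : 𝕜) * (ψ : ℝ → 𝕜) x) := by
    rw [inner_mulTest_left]
    refine integral_congr_ae ?_
    filter_upwards [mulTest_coeFn (sqrtPot V) ψ] with x hx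
    rw [hx, ← mul_assoc (RCLike.ofReal _ : 𝕜), ← RCLike.ofReal_mul]
    congr 3
    exact Real.mul_self_sqrt (hV x)
  have hV2 : Integrable (fun x => star ((φ : ℝ → 𝕜) x) * ((V x : 𝕜) * (ψ : ℝ → 𝕜) x)) :=
    (φ.2.1.continuous.star.mul ((RCLike.continuous_ofReal.comp V.continuous).mul
      ψ.2.1.continuous)).integrable_of_hasCompactSupport (ψ.2.2.mul_left.mul_left)
  have e4 : ⟪schrodingerTest 𝕜 V φ, testToL2 𝕜 ψ⟫_𝕜 =
      ∫ x, (-(star ((derivTest 𝕜 (derivTest 𝕜 φ) : ℝ → 𝕜) x) * (ψ : ℝ → 𝕜) x) +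
        star ((φ : ℝ → 𝕜) x) * ((V x : 𝕜) * (ψ : ℝ → 𝕜) x)) := by
    rw [L2.inner_def]
    refine integral_congr_ae ?_
    filter_upwards [(schrodingerFun_memLp V φ).coeFn_toLp, testToL2_coeFn ψ] with x h1 h2
    have h1' : (schrodingerTest 𝕜 V φ : ℝ → 𝕜) x = schrodingerFun V (φ : ℝ → 𝕜) x := h1
    have h3 : (derivTest 𝕜 (derivTest 𝕜 φ) : ℝ → 𝕜) x = deriv (deriv (φ : ℝ → 𝕜)) x := rfl
    rw [h1', h2, h3, RCLike.inner_apply, schrodingerFun, starRingEnd_apply]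
    simp only [star_add, star_neg, star_mul', RCLike.star_def, RCLike.conj_ofReal]
    ring
  have hin := (hi (derivTest 𝕜 (derivTest 𝕜 φ)) ψ).neg
  simp only [Pi.neg_def] at hin
  rw [e1, e2, e3, e4, integral_add hin hV2, integral_neg,
    integral_star_deriv_mul (derivTest 𝕜 φ) ψ, neg_neg]

lemma dense_range_testToL2 : Dense (LinearMap.range (testToL2 𝕜) : Set (L2 𝕜)) := by
  refine (Lp.dense_hasCompactSupport_contDiff (E := ℝ) (F := 𝕜) (μ := volume) (p := 2)
    (by simp)).mono ?_
  rintro f ⟨g, hfg, hgc, hgs⟩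
  exact ⟨⟨g, hgs, hgc⟩, Lp.ext ((testToL2_coeFn _).trans hfg.symm)⟩

/-- If the form of `-∂ₓ² + V` is bounded below by `c > 0`, then its Friedrichs extension has a
bounded inverse `G`. Moreover the weak derivative `D f` of `G f` and the product `R f = √V G f` are
in `L²(ℝ)`, and the equation `(-∂ₓ² + V) G f = f` holds in the sense of forms. -/
theorem exists_isBoundedInverse (V : C(ℝ, ℝ)) (hV : ∀ x, 0 ≤ V x) {c : ℝ} (hc : 0 < c)
    (hcoer : ∀ φ : testFunctions 𝕜, c * ‖testToL2 𝕜 φ‖ ^ 2 ≤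
      ‖testToL2 𝕜 (derivTest 𝕜 φ)‖ ^ 2 + ‖mulTest 𝕜 (sqrtPot V) φ‖ ^ 2) :
    ∃ G D R : L2 𝕜 →L[𝕜] L2 𝕜, IsBoundedInverse (schrodinger 𝕜 V hV) G ∧
      (∀ f, ∀ φ : testFunctions 𝕜, ⟪testToL2 𝕜 (derivTest 𝕜 φ), G f⟫_𝕜 =
        -⟪testToL2 𝕜 φ, D f⟫_𝕜) ∧
      (∀ f, ∀ φ : testFunctions 𝕜, ⟪testToL2 𝕜 φ, R f⟫_𝕜 = ⟪mulTest 𝕜 (sqrtPot V) φ, G f⟫_𝕜) ∧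
      (∀ f, ∀ φ : testFunctions 𝕜, ⟪testToL2 𝕜 (derivTest 𝕜 φ), D f⟫_𝕜 +
        ⟪mulTest 𝕜 (sqrtPot V) φ, R f⟫_𝕜 = ⟪testToL2 𝕜 φ, f⟫_𝕜) ∧
      (∀ f, ‖D f‖ ^ 2 + ‖R f‖ ^ 2 ≤ ‖G f‖ * ‖f‖) ∧
      (∀ f, c * ‖G f‖ ^ 2 ≤ ‖D f‖ ^ 2 + ‖R f‖ ^ 2) := by
  have hnorm : ∀ k : WithLp 2 (L2 𝕜 × L2 𝕜), ‖k‖ ^ 2 = ‖k.fst‖ ^ 2 + ‖k.snd‖ ^ 2 :=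
    fun k => WithLp.prod_norm_sq_eq_of_L2 k
  have hdr := denseRange_toFormSpace 𝕜 V
  have : CompleteSpace (formSpace 𝕜 V) :=
    (Submodule.isClosed_topologicalClosure _).completeSpace_coe
  have hbound : ∀ φ, ‖testToL2 𝕜 φ‖ ≤ (√c)⁻¹ * ‖toFormSpace 𝕜 V φ‖ := by
    intro φ
    have h1 : c * ‖testToL2 𝕜 φ‖ ^ 2 ≤ ‖toFormSpace 𝕜 V φ‖ ^ 2 :=
      (hcoer φ).trans_eq (hnorm (formEmbedding 𝕜 V φ)).symm
    rw [← Real.sqrt_le_sqrt_iff (by positivity), Real.sqrt_mul hc.le,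
      Real.sqrt_sq (norm_nonneg _), Real.sqrt_sq (norm_nonneg _)] at h1
    rwa [inv_mul_eq_div, le_div_iff₀' (by positivity)]
  set j := (testToL2 𝕜).extendOfNorm (toFormSpace 𝕜 V) with hj
  have hj1 : ∀ φ, j (toFormSpace 𝕜 V φ) = testToL2 𝕜 φ := fun φ =>
    LinearMap.extendOfNorm_eq hdr ⟨_, hbound⟩ φ
  let eqv := LinearEquiv.ofInjective (testToL2 𝕜) (testToL2_injective 𝕜)
  let e : (schrodingerMin 𝕜 V).domain →ₗ[𝕜] formSpace 𝕜 V :=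
    toFormSpace 𝕜 V ∘ₗ eqv.symm.toLinearMap
  have he : ∀ φ, e (eqv φ) = toFormSpace 𝕜 V φ := fun φ =>
    congrArg (toFormSpace 𝕜 V) (eqv.symm_apply_apply φ)
  have hed : DenseRange e := by
    refine hdr.mono ?_
    rintro _ ⟨φ, rfl⟩
    exact ⟨eqv φ, he φ⟩
  have hform : ∀ x y : (schrodingerMin 𝕜 V).domain, ⟪e x, e y⟫_𝕜 =
      ⟪schrodingerMin 𝕜 V x, (y : L2 𝕜)⟫_𝕜 := by
    intro x y
    obtain ⟨φ, rfl⟩ := eqv.surjective x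
    obtain ⟨ψ, rfl⟩ := eqv.surjective y
    rw [he, he]
    exact (inner_formEmbedding V hV φ ψ).trans (by rw [← schrodingerMin_apply]; rfl)
  have hje : ∀ x, j (e x) = x := by
    intro x
    obtain ⟨φ, rfl⟩ := eqv.surjective x
    rw [he, hj1]
    rfl
  let fstL : formSpace 𝕜 V →L[𝕜] L2 𝕜 :=
    (WithLp.fstL 2 𝕜 (L2 𝕜) (L2 𝕜)) ∘L (formSpace 𝕜 V).subtypeL
  let sndL : formSpace 𝕜 V →L[𝕜] L2 𝕜 :=
    (WithLp.sndL 2 𝕜 (L2 𝕜) (L2 𝕜)) ∘L (formSpace 𝕜 V).subtypeL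
  have hk : ∀ k : formSpace 𝕜 V, ‖k‖ ^ 2 = ‖fstL k‖ ^ 2 + ‖sndL k‖ ^ 2 := fun k => hnorm k
  refine ⟨j ∘L j.adjoint, fstL ∘L j.adjoint, sndL ∘L j.adjoint,
    isBoundedInverse_friedrichsExtension (schrodingerMin_isNonneg 𝕜 V hV)
      dense_range_testToL2 hed hform hje, ?_, ?_, ?_, ?_, ?_⟩
  · intro f φ
    refine hdr.induction_on (p := fun k => ⟪testToL2 𝕜 (derivTest 𝕜 φ), j k⟫_𝕜 =
      -⟪testToL2 𝕜 φ, fstL k⟫_𝕜) (j.adjoint f)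
      (isClosed_eq (by fun_prop) (by fun_prop)) fun ψ => ?_
    have h1 : fstL (toFormSpace 𝕜 V ψ) = testToL2 𝕜 (derivTest 𝕜 ψ) := rfl
    rw [hj1, h1, inner_testToL2_left, inner_testToL2_left]
    have := integral_star_deriv_mul φ ψ
    convert this using 1
    · refine integral_congr_ae ?_
      filter_upwards [testToL2_coeFn ψ] with x hx
      rw [hx]
    · congr 1
      refine integral_congr_ae ?_
      filter_upwards [testToL2_coeFn (derivTest 𝕜 ψ)] with x hx
      rw [hx]
  · intro f φ
    refine hdr.induction_on (p := fun k => ⟪testToL2 𝕜 φ, sndL k⟫_𝕜 =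
      ⟪mulTest 𝕜 (sqrtPot V) φ, j k⟫_𝕜) (j.adjoint f)
      (isClosed_eq (by fun_prop) (by fun_prop)) fun ψ => ?_
    have h1 : sndL (toFormSpace 𝕜 V ψ) = mulTest 𝕜 (sqrtPot V) ψ := rfl
    rw [hj1, h1, inner_testToL2_left, inner_mulTest_left]
    refine integral_congr_ae ?_
    filter_upwards [mulTest_coeFn (sqrtPot V) ψ, testToL2_coeFn ψ] with x hx hx'
    rw [hx, hx']
  · intro f φ
    have h1 : ⟪toFormSpace 𝕜 V φ, j.adjoint f⟫_𝕜 = ⟪testToL2 𝕜 φ, f⟫_𝕜 := by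
      rw [ContinuousLinearMap.adjoint_inner_right, hj1]
    exact h1
  · intro f
    have h1 : ‖j.adjoint f‖ ^ 2 ≤ ‖j (j.adjoint f)‖ * ‖f‖ := by
      rw [← inner_self_eq_norm_sq (𝕜 := 𝕜), ContinuousLinearMap.adjoint_inner_right]
      exact (RCLike.re_le_norm _).trans (norm_inner_le_norm _ _)
    exact (hk _).symm.trans_le h1
  · intro f
    have h1 := LinearMap.norm_extendOfNorm_apply_le hdr _ hbound (j.adjoint f)
    have h2 := pow_le_pow_left₀ (norm_nonneg _) h1 2
    rw [mul_pow, inv_pow, Real.sq_sqrt hc.le, inv_mul_eq_div, le_div_iff₀' hc, hk] at h2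
    exact h2

end FormSpace

/-! ### Interior regularity -/

section Regularity

variable {𝕜 : Type*} [RCLike 𝕜]

lemma integral_deriv_mul_primitive_real {g : ℝ → ℝ} (hg : LocallyIntegrable g volume) {φ : ℝ → ℝ}
    (hφ : ContDiff ℝ ∞ φ) (hc : HasCompactSupport φ) :
    ∫ x, deriv φ x * (∫ t in (0 : ℝ)..x, g t) = -∫ x, φ x * g x := by
  obtain ⟨R, hR, hφR⟩ := hc.exists_pos_le_norm
  have hII : IntervalIntegrable g volume (-R) R :=
    intervalIntegrable_iff.mpr <|
      (hg.integrableOn_isCompact isCompact_uIcc).mono_set uIoc_subset_uIcc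
  have hU := hII.absolutelyContinuousOnInterval_intervalIntegral (c := 0)
    (by rw [uIcc_of_le (by linarith)]; constructor <;> linarith)
  have hφac : AbsolutelyContinuousOnInterval φ (-R) R :=
    (hφ.of_le (by simp)).contDiffOn.absolutelyContinuousOnInterval
  have hparts := hφac.integral_mul_deriv_eq_deriv_mul hU
  rw [hφR R (le_abs_self R), hφR (-R) (by simp [abs_of_pos hR])] at hparts
  have hsupp : Function.support φ ⊆ Ioc (-R) R := by
    intro x hx
    by_contra h
    refine hx (hφR x ?_)
    rw [Real.norm_eq_abs, le_abs']
    by_contra! h'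
    exact h ⟨h'.1, h'.2.le⟩
  have hsupp' : Function.support (deriv φ) ⊆ Icc (-R) R := by
    refine (support_deriv_subset).trans ?_
    exact closure_minimal (hsupp.trans Ioc_subset_Icc_self) isClosed_Icc
  have e1 : ∫ x, φ x * g x = ∫ x in (-R)..R, φ x * g x :=
    (intervalIntegral.integral_eq_integral_of_support_subset
      ((Function.support_mul_subset_left _ _).trans hsupp)).symm
  have e2 : ∫ x, deriv φ x * (∫ t in (0 : ℝ)..x, g t) =
      ∫ x in (-R)..R, deriv φ x * (∫ t in (0 : ℝ)..x, g t) := by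
    rw [intervalIntegral.integral_of_le (by linarith), ← integral_Icc_eq_integral_Ioc,
      setIntegral_eq_integral_of_forall_compl_eq_zero]
    intro x hx
    rw [Function.notMem_support.1 fun h => hx (hsupp' h), zero_mul]
  have e3 : ∫ x in (-R)..R, φ x * deriv (fun x => ∫ t in (0 : ℝ)..x, g t) x =
      ∫ x in (-R)..R, φ x * g x := by
    refine intervalIntegral.integral_congr_ae ?_
    filter_upwards [_root_.LocallyIntegrable.ae_hasDerivAt_integral hg] with x hx _
    rw [(hx 0).deriv]
  rw [e1, e2, ← e3, hparts]
  ring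

/-- Integration by parts against the primitive of a locally integrable function. -/
lemma integral_deriv_smul_primitive {g : ℝ → 𝕜} (hg : LocallyIntegrable g volume) {φ : ℝ → ℝ}
    (hφ : ContDiff ℝ ∞ φ) (hc : HasCompactSupport φ) :
    ∫ x, deriv φ x • (∫ t in (0 : ℝ)..x, g t) = -∫ x, φ x • g x := by
  have hII : ∀ a b : ℝ, IntervalIntegrable g volume a b := fun a b =>
    intervalIntegrable_iff.mpr <|
      (hg.integrableOn_isCompact isCompact_uIcc).mono_set uIoc_subset_uIcc
  have hcont : Continuous fun x => ∫ t in (0 : ℝ)..x, g t :=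
    intervalIntegral.continuous_primitive hII 0
  have hi1 : Integrable fun x => deriv φ x • (∫ t in (0 : ℝ)..x, g t) :=
    ((hφ.continuous_deriv (by simp)).smul hcont).integrable_of_hasCompactSupport
      hc.deriv.smul_right
  have hi2 : Integrable fun x => φ x • g x :=
    hg.integrable_smul_left_of_hasCompactSupport hφ.continuous hc
  -- A real linear functional reduces the identity to real-valued functions.
  have key : ∀ L : 𝕜 →L[ℝ] ℝ, L (∫ x, deriv φ x • (∫ t in (0 : ℝ)..x, g t)) =
      L (-∫ x, φ x • g x) := by
    intro L
    have hL : LocallyIntegrable (fun x => L (g x)) volume := fun x =>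
      let ⟨s, hs, hi⟩ := hg x
      ⟨s, hs, L.integrable_comp hi⟩
    rw [map_neg, ← L.integral_comp_comm hi1, ← L.integral_comp_comm hi2]
    simp only [map_smul, smul_eq_mul]
    rw [← integral_deriv_mul_primitive_real hL hφ hc]
    refine integral_congr_ae (Eventually.of_forall fun x => ?_)
    simp only
    rw [L.intervalIntegral_comp_comm (hII 0 x)]
  exact RCLike.ext (key RCLike.reCLM) (key RCLike.imCLM)

/-- The lemma of du Bois-Reymond: a function with vanishing weak derivative is constant. -/
lemma exists_ae_eq_const_of_integral_deriv_smul_eq_zero {u : ℝ → 𝕜}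
    (hu : LocallyIntegrable u volume)
    (h : ∀ φ : ℝ → ℝ, ContDiff ℝ ∞ φ → HasCompactSupport φ → ∫ x, deriv φ x • u x = 0) :
    ∃ c : 𝕜, ∀ᵐ x, u x = c := by
  let b : ContDiffBump (0 : ℝ) := default
  set χ : ℝ → ℝ := b.normed volume with hχ
  have hχs : ContDiff ℝ ∞ χ := b.contDiff_normed
  have hχc : HasCompactSupport χ := b.hasCompactSupport_normed
  have hχi : ∫ x, χ x = 1 := b.integral_normed
  refine ⟨∫ x, χ x • u x, ?_⟩
  have hmain := ae_eq_of_integral_contDiff_smul_eq (f := u) (f' := fun _ => ∫ x, χ x • u x) hu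
    (continuous_const.locallyIntegrable) ?_
  · exact hmain
  intro φ hφ hφc
  set m := ∫ x, φ x with hm
  set ρ : ℝ → ℝ := fun x => φ x - m * χ x with hρ
  have hρs : ContDiff ℝ ∞ ρ := hφ.sub (contDiff_const.mul hχs)
  have hρc : HasCompactSupport ρ := hφc.sub (hχc.mul_left (f := fun _ => m))
  have hρi : Integrable ρ := hρs.continuous.integrable_of_hasCompactSupport hρc
  have hρ0 : ∫ x, ρ x = 0 := by
    rw [hρ, integral_sub (hφ.continuous.integrable_of_hasCompactSupport hφc)
      ((hχs.continuous.integrable_of_hasCompactSupport hχc).const_mul m), integral_const_mul, hχi]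
    simp [hm]
  obtain ⟨R, hR, hρR⟩ := hρc.exists_pos_le_norm
  set ψ : ℝ → ℝ := fun x => ∫ t in (-R)..x, ρ t with hψ
  have hψd : ∀ x, HasDerivAt ψ (ρ x) x := fun x =>
    intervalIntegral.integral_hasDerivAt_right (hρi.intervalIntegrable)
      (hρs.continuous.stronglyMeasurableAtFilter _ _) hρs.continuous.continuousAt
  have hψderiv : deriv ψ = ρ := funext fun x => (hψd x).deriv
  have hψs : ContDiff ℝ ∞ ψ := by
    rw [contDiff_infty_iff_deriv, hψderiv]
    exact ⟨fun x => (hψd x).differentiableAt, hρs⟩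
  have hψ0 : ∀ x, R ≤ |x| → ψ x = 0 := by
    intro x hx
    rcases le_abs.1 hx with hx | hx
    · have : ψ x = ∫ t, ρ t := by
        refine intervalIntegral.integral_eq_integral_of_support_subset ?_
        intro y hy
        by_contra hy'
        refine hy (hρR y ?_)
        rw [Real.norm_eq_abs, le_abs']
        by_contra! h'
        exact hy' ⟨h'.1, h'.2.le.trans hx⟩
      rw [this, hρ0]
    · have : ψ x = ∫ t in (-R)..x, (0 : ℝ) := by
        refine intervalIntegral.integral_congr fun y hy => hρR y ?_
        rw [uIcc_of_ge (by linarith)] at hy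
        rw [Real.norm_eq_abs, le_abs']
        exact Or.inl hy.2
      rw [this, intervalIntegral.integral_zero]
  have hψc : HasCompactSupport ψ := by
    refine HasCompactSupport.intro (isCompact_Icc (a := -R) (b := R)) fun x hx => hψ0 x ?_
    rw [le_abs']
    by_contra! h'
    exact hx ⟨h'.1.le, h'.2.le⟩
  have h0 := h ψ hψs hψc
  rw [hψderiv] at h0
  have hi1 : Integrable fun x => φ x • u x :=
    hu.integrable_smul_left_of_hasCompactSupport hφ.continuous hφc
  have hi2 : Integrable fun x => χ x • u x :=
    hu.integrable_smul_left_of_hasCompactSupport hχs.continuous hχc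
  simp only [hρ, sub_smul, mul_smul] at h0
  have hi3 : Integrable fun x => m • χ x • u x := hi2.smul m
  rw [integral_sub hi1 hi3, integral_smul, sub_eq_zero] at h0
  rw [h0, integral_smul_const]

/-- A function with a locally integrable weak derivative is a primitive of it. -/
lemma exists_ae_eq_primitive {u g : ℝ → 𝕜} (hu : LocallyIntegrable u volume)
    (hg : LocallyIntegrable g volume)
    (h : ∀ φ : ℝ → ℝ, ContDiff ℝ ∞ φ → HasCompactSupport φ →
      ∫ x, deriv φ x • u x = -∫ x, φ x • g x) :
    ∃ c : 𝕜, ∀ᵐ x, u x = c + ∫ t in (0 : ℝ)..x, g t := by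
  have hII : ∀ a b : ℝ, IntervalIntegrable g volume a b := fun a b =>
    intervalIntegrable_iff.mpr <|
      (hg.integrableOn_isCompact isCompact_uIcc).mono_set uIoc_subset_uIcc
  have hcont : Continuous fun x => ∫ t in (0 : ℝ)..x, g t :=
    intervalIntegral.continuous_primitive hII 0
  obtain ⟨c, hc⟩ := exists_ae_eq_const_of_integral_deriv_smul_eq_zero
    (u := fun x => u x - ∫ t in (0 : ℝ)..x, g t) (hu.sub hcont.locallyIntegrable) (by
      intro φ hφ hφc
      simp only [smul_sub]
      rw [integral_sub (hu.integrable_smul_left_of_hasCompactSupport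
        (hφ.continuous_deriv (by simp)) hφc.deriv)
        (hcont.locallyIntegrable.integrable_smul_left_of_hasCompactSupport
        (hφ.continuous_deriv (by simp)) hφc.deriv), h φ hφ hφc,
        integral_deriv_smul_primitive hg hφ hφc, sub_self])
  exact ⟨c, hc.mono fun x hx => by rw [← hx]; ring⟩

/-- A real-valued test function, as a test function with values in `𝕜`. -/
noncomputable def ofRealTest (φ : ℝ → ℝ) (hφ : ContDiff ℝ ∞ φ) (hc : HasCompactSupport φ) :
    testFunctions 𝕜 :=
  ⟨fun x => (φ x : 𝕜), (RCLike.ofRealCLM (K := 𝕜)).contDiff.comp hφ,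
    hc.comp_left (g := fun r : ℝ => (r : 𝕜)) RCLike.ofReal_zero⟩

lemma derivTest_ofRealTest (φ : ℝ → ℝ) (hφ : ContDiff ℝ ∞ φ) (hc : HasCompactSupport φ) (x : ℝ) :
    (derivTest 𝕜 (ofRealTest φ hφ hc) : ℝ → 𝕜) x = ((deriv φ x : ℝ) : 𝕜) :=
  ((RCLike.ofRealCLM (K := 𝕜)).hasFDerivAt.comp_hasDerivAt x
    (hφ.differentiable (by simp) x).hasDerivAt).deriv

lemma L2.locallyIntegrable (u : L2 𝕜) : LocallyIntegrable (u : ℝ → 𝕜) volume :=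
  (Lp.memLp u).locallyIntegrable (by norm_num)

/-- Interior regularity: if `u` solves `-u'' + V u = f` in the sense of forms and `f` is
continuous, then `u` is a classical solution. -/
theorem exists_classical_solution (V : C(ℝ, ℝ)) (hV : ∀ x, 0 ≤ V x) (u g r f : L2 𝕜)
    (hg : ∀ φ : testFunctions 𝕜, ⟪testToL2 𝕜 (derivTest 𝕜 φ), u⟫_𝕜 = -⟪testToL2 𝕜 φ, g⟫_𝕜)
    (hr : ∀ φ : testFunctions 𝕜, ⟪testToL2 𝕜 φ, r⟫_𝕜 = ⟪mulTest 𝕜 (sqrtPot V) φ, u⟫_𝕜)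
    (hf : ∀ φ : testFunctions 𝕜, ⟪testToL2 𝕜 (derivTest 𝕜 φ), g⟫_𝕜 +
        ⟪mulTest 𝕜 (sqrtPot V) φ, r⟫_𝕜 = ⟪testToL2 𝕜 φ, f⟫_𝕜)
    {F : ℝ → 𝕜} (hF : Continuous F) (hfF : f =ᵐ[volume] F) :
    ∃ v v' : ℝ → 𝕜, u =ᵐ[volume] v ∧ g =ᵐ[volume] v' ∧ (∀ x, HasDerivAt v (v' x) x) ∧
      (∀ x, HasDerivAt v' ((V x : 𝕜) * v x - F x) x) ∧
      r =ᵐ[volume] fun x => (√(V x) : 𝕜) * v x := by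
  have hu_loc := L2.locallyIntegrable u
  have hcV : Continuous fun x => ((V x : ℝ) : 𝕜) := RCLike.continuous_ofReal.comp V.continuous
  have hcsV : Continuous fun x => ((sqrtPot V x : ℝ) : 𝕜) :=
    RCLike.continuous_ofReal.comp (sqrtPot V).continuous
  have hmul : ∀ {W : ℝ → 𝕜}, Continuous W → ∀ w : L2 𝕜,
      LocallyIntegrable (fun x => W x * w x) volume := fun hW w =>
    (L2.locallyIntegrable w).continuous_mul hW
  have hstar : ∀ (φ : ℝ → ℝ) (hφ : ContDiff ℝ ∞ φ) (hc : HasCompactSupport φ) (w : ℝ → 𝕜),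
      ∫ x, star ((ofRealTest (𝕜 := 𝕜) φ hφ hc : ℝ → 𝕜) x) * w x = ∫ x, φ x • w x := by
    intro φ hφ hc w
    refine integral_congr_ae (Eventually.of_forall fun x => ?_)
    simp only [ofRealTest, RCLike.star_def, RCLike.conj_ofReal, RCLike.real_smul_eq_coe_mul]
  have hstar' : ∀ (φ : ℝ → ℝ) (hφ : ContDiff ℝ ∞ φ) (hc : HasCompactSupport φ) (w : ℝ → 𝕜),
      ∫ x, star ((derivTest 𝕜 (ofRealTest (𝕜 := 𝕜) φ hφ hc) : ℝ → 𝕜) x) * w x =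
        ∫ x, deriv φ x • w x := by
    intro φ hφ hc w
    refine integral_congr_ae (Eventually.of_forall fun x => ?_)
    simp only [derivTest_ofRealTest, RCLike.star_def, RCLike.conj_ofReal,
      RCLike.real_smul_eq_coe_mul]
  have hru : ∀ᵐ x, r x = (sqrtPot V x : 𝕜) * u x := by
    refine ae_eq_of_integral_contDiff_smul_eq (L2.locallyIntegrable r) (hmul hcsV u) ?_
    intro φ hφ hc
    have := hr (ofRealTest φ hφ hc)
    rwa [inner_testToL2_left, inner_mulTest_left, hstar, hstar] at this
  have hsq : ∀ x, (sqrtPot V x : 𝕜) * (sqrtPot V x : 𝕜) = (V x : 𝕜) := fun x => by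
    rw [← RCLike.ofReal_mul]
    exact congrArg _ (Real.mul_self_sqrt (hV x))
  set h : ℝ → 𝕜 := fun x => (V x : 𝕜) * u x - f x with hh
  have hh_loc : LocallyIntegrable h volume := (hmul hcV u).sub (L2.locallyIntegrable f)
  obtain ⟨c₁, hc₁⟩ := exists_ae_eq_primitive (L2.locallyIntegrable g) hh_loc (by
    intro φ hφ hc
    have h1 := hf (ofRealTest φ hφ hc)
    rw [inner_testToL2_left, inner_mulTest_left, inner_testToL2_left, hstar, hstar, hstar'] at h1
    have h2 : ∫ x, φ x • ((sqrtPot V x : 𝕜) * r x) = ∫ x, φ x • ((V x : 𝕜) * u x) := by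
      refine integral_congr_ae ?_
      filter_upwards [hru] with x hx
      rw [hx, ← mul_assoc, hsq]
    rw [h2] at h1
    simp only [hh, smul_sub]
    rw [integral_sub ((hmul hcV u).integrable_smul_left_of_hasCompactSupport hφ.continuous hc)
      ((L2.locallyIntegrable f).integrable_smul_left_of_hasCompactSupport hφ.continuous hc),
      ← h1]
    ring)
  obtain ⟨c₀, hc₀⟩ := exists_ae_eq_primitive hu_loc (L2.locallyIntegrable g) (by
    intro φ hφ hc
    have h1 := hg (ofRealTest φ hφ hc)
    rwa [inner_testToL2_left, inner_testToL2_left, hstar, hstar'] at h1)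
  set v' : ℝ → 𝕜 := fun x => c₁ + ∫ t in (0 : ℝ)..x, h t with hv'
  have hII : ∀ a b : ℝ, IntervalIntegrable h volume a b := fun a b =>
    intervalIntegrable_iff.mpr <|
      (hh_loc.integrableOn_isCompact isCompact_uIcc).mono_set uIoc_subset_uIcc
  have hv'c : Continuous v' :=
    continuous_const.add (intervalIntegral.continuous_primitive hII 0)
  set v : ℝ → 𝕜 := fun x => c₀ + ∫ t in (0 : ℝ)..x, v' t with hv
  have hvd : ∀ x, HasDerivAt v (v' x) x := fun x =>
    (intervalIntegral.integral_hasDerivAt_right (hv'c.intervalIntegrable _ _)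
      (hv'c.stronglyMeasurableAtFilter _ _) hv'c.continuousAt).const_add c₀
  have hvc : Continuous v := continuous_iff_continuousAt.2 fun x => (hvd x).continuousAt
  have huv : ∀ᵐ x, u x = v x := by
    filter_upwards [hc₀] with x hx
    rw [hx, hv]
    congr 1
    exact intervalIntegral.integral_congr_ae (hc₁.mono fun t ht _ => ht)
  refine ⟨v, v', huv, hc₁, hvd, fun x => ?_, ?_⟩
  · have hcont : Continuous fun x => (V x : 𝕜) * v x - F x := (hcV.mul hvc).sub hF
    have hv'2 : v' = fun x => c₁ + ∫ t in (0 : ℝ)..x, ((V t : 𝕜) * v t - F t) := by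
      funext x
      simp only [hv']
      congr 1
      refine intervalIntegral.integral_congr_ae ?_
      filter_upwards [huv, hfF] with t h1 h2 _
      rw [hh]
      simp only [h1, h2]
    rw [hv'2]
    exact (intervalIntegral.integral_hasDerivAt_right (hcont.intervalIntegrable _ _)
      (hcont.stronglyMeasurableAtFilter _ _) hcont.continuousAt).const_add c₁
  · filter_upwards [hru, huv] with x h1 h2
    rw [h1, h2]
    rfl

/-- The sesquilinear and the bilinear formulations of the weak derivative agree. -/
lemma isWeakDeriv_of_inner {u g : L2 𝕜}
    (hg : ∀ φ : testFunctions 𝕜, ⟪testToL2 𝕜 (derivTest 𝕜 φ), u⟫_𝕜 = -⟪testToL2 𝕜 φ, g⟫_𝕜) :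
    IsWeakDeriv u g := by
  intro φ hφ
  let ψ : testFunctions 𝕜 := ⟨fun x => star (φ x), (RCLike.conjCLE (K := 𝕜)).contDiff.comp hφ.1,
    hφ.2.comp_left (g := fun z : 𝕜 => star z) (star_zero 𝕜)⟩
  have hd : ∀ x, (derivTest 𝕜 ψ : ℝ → 𝕜) x = star (deriv φ x) := fun x =>
    ((hφ.1.differentiable (by simp) x).hasDerivAt.star).deriv
  have h1 := hg ψ
  rw [inner_testToL2_left, inner_testToL2_left] at h1
  simp only [hd, ψ, star_star] at h1
  simpa only [mul_comm] using h1

end Regularity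

/-! ### The estimate for the inverse of `L_-^ε` -/

section LminusEstimate

lemma sq_intervalIntegral_mul_le {f g : ℝ → ℝ} {a b : ℝ} (hab : a ≤ b) (hf : Continuous f)
    (hg : Continuous g) :
    (∫ x in a..b, f x * g x) ^ 2 ≤ (∫ x in a..b, f x ^ 2) * ∫ x in a..b, g x ^ 2 := by
  have h : ∀ t : ℝ, 0 ≤ (∫ x in a..b, g x ^ 2) * (t * t) + (2 * ∫ x in a..b, f x * g x) * t +
      ∫ x in a..b, f x ^ 2 := by
    intro t
    have h1 : 0 ≤ ∫ x in a..b, (f x + t * g x) ^ 2 :=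
      intervalIntegral.integral_nonneg hab fun x _ => sq_nonneg _
    have h2 : ∫ x in a..b, (f x + t * g x) ^ 2 = ∫ x in a..b,
        ((t * t) * g x ^ 2 + (2 * t) * (f x * g x) + f x ^ 2) := by
      congr 1
      funext x
      ring
    rw [h2, intervalIntegral.integral_add, intervalIntegral.integral_add,
      intervalIntegral.integral_const_mul, intervalIntegral.integral_const_mul] at h1
    · linarith
    all_goals exact Continuous.intervalIntegrable (by fun_prop) _ _
  have := discrim_le_zero h
  rw [discrim] at this
  linarith

lemma intervalIntegral_le_integral {g : ℝ → ℝ} {a b : ℝ} (hab : a ≤ b) (hg : Integrable g)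
    (h0 : ∀ x, 0 ≤ g x) : ∫ x in a..b, g x ≤ ∫ x, g x := by
  rw [intervalIntegral.integral_of_le hab]
  exact setIntegral_le_integral hg (Eventually.of_forall h0)

lemma exists_ge_lt_of_integrable {g : ℝ → ℝ} (hg : Integrable g) (N : ℝ) {η : ℝ} (hη : 0 < η) :
    ∃ R, N ≤ R ∧ g R < η := by
  by_contra! h
  have h1 : IntegrableOn (fun _ : ℝ => η) (Ici N) := by
    refine Integrable.mono (hg.integrableOn (s := Ici N)) aestronglyMeasurable_const ?_
    filter_upwards [ae_restrict_mem measurableSet_Ici] with x hx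
    rw [Real.norm_of_nonneg hη.le]
    exact (h x hx).trans (le_abs_self _)
  rw [integrableOn_const_iff] at h1
  simp [hη.ne'] at h1

lemma le_of_quadratic_system {a X e N : ℝ} (he : 0 < e) (he1 : e ≤ 1) (hN : 0 < N)
    (h1 : a ^ 2 ≤ (e ^ 3) ^ 2 * N ^ 2 + 4 * e ^ 3 * N * X)
    (h2 : X ^ 2 ≤ (e ^ 3) ^ 2 * N ^ 2 + 2 * N * a + 2 * e ^ 3 * N * N) : X ≤ 4 * e * N := by
  -- With `a = N e² β` and `X = N e γ` the assumptions read `β² ≤ 1 + 4 γ` and `γ² ≤ 3 + 2 β`.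
  obtain ⟨β, rfl⟩ : ∃ β, a = N * e ^ 2 * β := ⟨a / (N * e ^ 2), by field_simp⟩
  obtain ⟨γ, rfl⟩ : ∃ γ, X = N * e * γ := ⟨X / (N * e), by field_simp⟩
  have he2 : e ^ 2 ≤ 1 := pow_le_one₀ he.le he1
  have he4 : e ^ 4 ≤ 1 := pow_le_one₀ he.le he1
  have hβ : β ^ 2 ≤ e ^ 2 + 4 * γ := by
    refine le_of_mul_le_mul_left (a := N ^ 2 * e ^ 4) ?_ (by positivity)
    linarith
  have hγ : γ ^ 2 ≤ e ^ 4 + 2 * β + 2 * e := by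
    refine le_of_mul_le_mul_left (a := N ^ 2 * e ^ 2) ?_ (by positivity)
    linarith
  have hγ4 : γ ≤ 4 := by
    by_contra! h
    nlinarith only [h, hβ, hγ, he1, he2, he4, sq_nonneg (β - 5)]
  nlinarith only [hγ4, mul_pos hN he]

lemma pFun_of_one_le (ε : ℝ) {x : ℝ} (hx : 1 ≤ |x|) : pFun ε x = (x ^ 2 - 1) / ε ^ 2 := by
  rw [pFun, indicator_outer_eq, max_eq_left (by nlinarith [sq_abs x])]
  ring

lemma pFun_of_le_one (ε : ℝ) {x : ℝ} (hx : |x| ≤ 1) : pFun ε x = 0 := by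
  rw [pFun, indicator_outer_eq, max_eq_right (by nlinarith [sq_abs x, abs_nonneg x]), mul_zero]

set_option maxHeartbeats 800000 in
/-- Pointwise bound on the half-line `x ≥ 0` for solutions of `-u'' + p_ε u = F`, with `ε = e³`.
Multiplying the equation by `u'` on `[1, ∞)` gives `‖u‖_{L²(1,∞)} ≲ ε`, because `p_ε' ≥ 2 ε⁻²`
there; multiplying it by `u` then gives `‖u'‖_{L²(1,∞)} ≲ ε^{1/3}` and `|u| ≲ ε^{2/3}` there. -/
lemma abs_le_of_pFun_equation_of_nonneg {u u' F : ℝ → ℝ} {e N : ℝ} (he : 0 < e) (he1 : e ≤ 1)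
    (hN : 0 < N) (hF : Continuous F) (hu : ∀ x, HasDerivAt u (u' x) x)
    (hu' : ∀ x, HasDerivAt u' (pFun (e ^ 3) x * u x - F x) x)
    (iu : Integrable fun x => u x ^ 2) (iu' : Integrable fun x => u' x ^ 2)
    (ip : Integrable fun x => pFun (e ^ 3) x * u x ^ 2) (iF : Integrable fun x => F x ^ 2)
    (bu' : ∫ x, u' x ^ 2 ≤ N ^ 2) (bF : ∫ x, F x ^ 2 ≤ N ^ 2) {x : ℝ} (hx : 0 ≤ x) :
    |u x| ≤ 5 * N * (e ^ 2 + max (1 - x ^ 2) 0) := by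
  have cu : Continuous u := continuous_iff_continuousAt.2 fun x => (hu x).continuousAt
  have cu' : Continuous u' := continuous_iff_continuousAt.2 fun x => (hu' x).continuousAt
  have bF' : ∀ a b, a ≤ b → ∫ x in a..b, F x ^ 2 ≤ N ^ 2 := fun a b hab =>
    (intervalIntegral_le_integral hab iF fun x => sq_nonneg _).trans bF
  have bu'' : ∀ a b, a ≤ b → ∫ x in a..b, u' x ^ 2 ≤ N ^ 2 := fun a b hab =>
    (intervalIntegral_le_integral hab iu' fun x => sq_nonneg _).trans bu'
  have hdu' : ∀ x, 1 ≤ x → HasDerivAt u' ((x ^ 2 - 1) / (e ^ 3) ^ 2 * u x - F x) x := by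
    intro x hx
    have := hu' x
    rwa [pFun_of_one_le _ (hx.trans (le_abs_self x))] at this
  -- The derivative is bounded on `[0, 1]`.
  have hosc : ∀ y z, 0 ≤ y → y ≤ z → z ≤ 1 → |u' z - u' y| ≤ N := by
    intro y z hy hyz hz
    have h1 : ∫ t in y..z, -F t = u' z - u' y := by
      refine intervalIntegral.integral_eq_sub_of_hasDerivAt (fun t ht => ?_)
        (hF.neg.intervalIntegrable _ _)
      rw [uIcc_of_le hyz] at ht
      have := hu' t
      rwa [pFun_of_le_one _ (abs_le.2 ⟨by linarith [ht.1], by linarith [ht.2]⟩), zero_mul,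
        zero_sub] at this
    have h2 := sq_intervalIntegral_mul_le hyz hF.neg (continuous_const (y := (1 : ℝ)))
    simp only [mul_one, one_pow, Pi.neg_apply, neg_sq, intervalIntegral.integral_const,
      smul_eq_mul] at h2
    rw [h1] at h2
    refine abs_le_of_sq_le_sq ?_ hN.le
    have h3 : 0 ≤ ∫ x in y..z, F x ^ 2 :=
      intervalIntegral.integral_nonneg hyz fun x _ => sq_nonneg _
    nlinarith [bF' y z hyz]
  have hlip : ∀ y, 0 ≤ y → y ≤ 1 → |u' y| ≤ 2 * N := by
    intro y hy hy1
    by_contra! hcon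
    have h1 : ∀ z ∈ Icc (0 : ℝ) 1, (|u' y| - N) ^ 2 ≤ u' z ^ 2 := by
      intro z hz
      have h2 : |u' y - u' z| ≤ N := by
        rcases le_total y z with h | h
        · rw [abs_sub_comm]
          exact hosc y z hy h hz.2
        · exact hosc z y hz.1 h hy1
      have h3 : |u' y| - N ≤ |u' z| := by linarith [abs_sub_abs_le_abs_sub (u' y) (u' z)]
      rw [← sq_abs (u' z)]
      exact pow_le_pow_left₀ (by linarith) h3 2
    have h4 := intervalIntegral.integral_mono_on (a := 0) (b := 1) (μ := volume) zero_le_one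
      (continuous_const.intervalIntegrable _ _) ((cu'.pow 2).intervalIntegrable _ _) h1
    rw [intervalIntegral.integral_const, sub_zero, one_smul] at h4
    have h5 : N ^ 2 < (|u' y| - N) ^ 2 := pow_lt_pow_left₀ (by linarith) hN.le (by simp)
    have h6 := bu'' 0 1 zero_le_one
    simp only [Pi.pow_apply] at h4
    linarith
  have hη : 0 < (e ^ 3) ^ 2 * N ^ 2 := by positivity
  have hη1 : (e ^ 3) ^ 2 * N ^ 2 ≤ N ^ 2 := by
    have : (e ^ 3) ^ 2 ≤ 1 := pow_le_one₀ (by positivity) (pow_le_one₀ he.le he1)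
    nlinarith [sq_nonneg N]
  -- Arbitrarily far points at which all the boundary terms are negligible.
  have hfar : ∀ M, 1 ≤ M → ∃ R, M ≤ R ∧ u R ^ 2 ≤ (e ^ 3) ^ 2 * N ^ 2 ∧
      u' R ^ 2 ≤ (e ^ 3) ^ 2 * N ^ 2 ∧
      (R ^ 2 - 1) / (e ^ 3) ^ 2 * u R ^ 2 ≤ (e ^ 3) ^ 2 * N ^ 2 := by
    intro M hM
    obtain ⟨R, hMR, hR⟩ := exists_ge_lt_of_integrable ((iu.add iu').add ip) M hη
    simp only [Pi.add_apply] at hR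
    have h1 := mul_nonneg (pFun_nonneg (e ^ 3) R) (sq_nonneg (u R))
    have h2 := sq_nonneg (u R)
    have h3 := sq_nonneg (u' R)
    refine ⟨R, hMR, by linarith, by linarith, ?_⟩
    rw [← pFun_of_one_le _ ((hM.trans hMR).trans (le_abs_self R))]
    linarith
  -- The multiplier `u'`.
  have hL2 : ∀ R, 1 ≤ R → ∫ t in (1 : ℝ)..R, u t ^ 2 ≤ (2 * e ^ 3 * N) ^ 2 := by
    intro R₀ hR₀
    obtain ⟨R, hR₀R, -, -, hR⟩ := hfar R₀ hR₀
    have hR1 : 1 ≤ R := hR₀.trans hR₀R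
    have hmono : ∫ t in (1 : ℝ)..R₀, u t ^ 2 ≤ ∫ t in (1 : ℝ)..R, u t ^ 2 :=
      intervalIntegral.integral_mono_interval le_rfl hR₀ hR₀R
        (Eventually.of_forall fun t => sq_nonneg _) ((cu.pow 2).intervalIntegrable _ _)
    have hE : ∫ t in (1 : ℝ)..R, ((-2) * (F t * u' t) + -(2 * t / (e ^ 3) ^ 2 * u t ^ 2)) =
        (u' R ^ 2 - (R ^ 2 - 1) / (e ^ 3) ^ 2 * u R ^ 2) -
          (u' 1 ^ 2 - ((1 : ℝ) ^ 2 - 1) / (e ^ 3) ^ 2 * u 1 ^ 2) := by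
      refine intervalIntegral.integral_eq_sub_of_hasDerivAt
        (f := fun t => u' t ^ 2 - (t ^ 2 - 1) / (e ^ 3) ^ 2 * u t ^ 2) (fun t ht => ?_)
        (Continuous.intervalIntegrable (by fun_prop) _ _)
      rw [uIcc_of_le hR1] at ht
      have h1 := ((hdu' t ht.1).pow 2).sub (((((hasDerivAt_id t).pow 2).sub_const 1).div_const
        ((e ^ 3) ^ 2)).mul ((hu t).pow 2))
      refine h1.congr_deriv ?_
      simp only [id_eq, Pi.pow_apply, Nat.cast_ofNat]
      ring
    rw [one_pow, sub_self, zero_div, zero_mul, sub_zero, intervalIntegral.integral_add,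
      intervalIntegral.integral_const_mul,
      intervalIntegral.integral_neg] at hE
    rotate_left
    · exact Continuous.intervalIntegrable (by fun_prop) _ _
    · exact Continuous.intervalIntegrable (by fun_prop) _ _
    have hlow : 2 / (e ^ 3) ^ 2 * ∫ t in (1 : ℝ)..R, u t ^ 2 ≤
        ∫ t in (1 : ℝ)..R, 2 * t / (e ^ 3) ^ 2 * u t ^ 2 := by
      rw [← intervalIntegral.integral_const_mul]
      refine intervalIntegral.integral_mono_on hR1
        (Continuous.intervalIntegrable (by fun_prop) _ _)
        (Continuous.intervalIntegrable (by fun_prop) _ _) fun t ht => ?_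
      gcongr
      linarith [ht.1]
    have hcs : |∫ t in (1 : ℝ)..R, F t * u' t| ≤ N ^ 2 := by
      refine abs_le_of_sq_le_sq ?_ (by positivity)
      refine (sq_intervalIntegral_mul_le hR1 hF cu').trans ?_
      rw [sq (N ^ 2)]
      exact mul_le_mul (bF' _ _ hR1) (bu'' _ _ hR1)
        (intervalIntegral.integral_nonneg hR1 fun x _ => sq_nonneg _) (by positivity)
    have h1 : u' 1 ^ 2 ≤ (2 * N) ^ 2 := by
      rw [← sq_abs]
      exact pow_le_pow_left₀ (abs_nonneg _) (hlip 1 zero_le_one le_rfl) 2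
    have h2 : 2 / (e ^ 3) ^ 2 * ∫ t in (1 : ℝ)..R, u t ^ 2 ≤ 8 * N ^ 2 := by
      have := abs_le.1 hcs
      nlinarith [sq_nonneg (u' R)]
    rw [div_mul_eq_mul_div, div_le_iff₀ (by positivity)] at h2
    nlinarith
  -- The multiplier `u`.
  have hmult : ∀ R, 1 ≤ R → u R ^ 2 ≤ (e ^ 3) ^ 2 * N ^ 2 → u' R ^ 2 ≤ (e ^ 3) ^ 2 * N ^ 2 →
      ∫ t in (1 : ℝ)..R, u' t ^ 2 ≤ (4 * e * N) ^ 2 := by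
    intro R hR1 hRu hRu'
    set X := √(∫ t in (1 : ℝ)..R, u' t ^ 2) with hX
    have hX0 : 0 ≤ X := Real.sqrt_nonneg _
    have hXsq : X ^ 2 = ∫ t in (1 : ℝ)..R, u' t ^ 2 :=
      Real.sq_sqrt (intervalIntegral.integral_nonneg hR1 fun x _ => sq_nonneg _)
    have hcs1 : |∫ t in (1 : ℝ)..R, u t * u' t| ≤ 2 * e ^ 3 * N * X := by
      refine abs_le_of_sq_le_sq ?_ (by positivity)
      refine (sq_intervalIntegral_mul_le hR1 cu cu').trans ?_
      rw [mul_pow, hXsq]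
      exact mul_le_mul_of_nonneg_right (hL2 R hR1)
        (intervalIntegral.integral_nonneg hR1 fun x _ => sq_nonneg _)
    have hcs2 : |∫ t in (1 : ℝ)..R, u t * F t| ≤ 2 * e ^ 3 * N * N := by
      refine abs_le_of_sq_le_sq ?_ (by positivity)
      refine (sq_intervalIntegral_mul_le hR1 cu hF).trans ?_
      rw [mul_pow _ N]
      exact mul_le_mul (hL2 R hR1) (bF' _ _ hR1)
        (intervalIntegral.integral_nonneg hR1 fun x _ => sq_nonneg _) (by positivity)
    have hI1 : ∫ t in (1 : ℝ)..R, 2 * (u t * u' t) = u R ^ 2 - u 1 ^ 2 := by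
      refine intervalIntegral.integral_eq_sub_of_hasDerivAt (f := fun t => u t ^ 2)
        (fun t _ => ?_) (Continuous.intervalIntegrable (by fun_prop) _ _)
      exact ((hu t).pow 2).congr_deriv (by ring)
    rw [intervalIntegral.integral_const_mul] at hI1
    have hI2 : ∫ t in (1 : ℝ)..R, ((u' t ^ 2 + (t ^ 2 - 1) / (e ^ 3) ^ 2 * u t ^ 2) +
        -(u t * F t)) = u R * u' R - u 1 * u' 1 := by
      refine intervalIntegral.integral_eq_sub_of_hasDerivAt (f := fun t => u t * u' t)
        (fun t ht => ?_) (Continuous.intervalIntegrable (by fun_prop) _ _)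
      rw [uIcc_of_le hR1] at ht
      exact ((hu t).mul (hdu' t ht.1)).congr_deriv (by ring)
    rw [intervalIntegral.integral_add, intervalIntegral.integral_add,
      intervalIntegral.integral_neg, ← hXsq] at hI2
    rotate_left
    · exact Continuous.intervalIntegrable (by fun_prop) _ _
    · exact Continuous.intervalIntegrable (by fun_prop) _ _
    · exact Continuous.intervalIntegrable (by fun_prop) _ _
    · exact Continuous.intervalIntegrable (by fun_prop) _ _
    have hpos : 0 ≤ ∫ t in (1 : ℝ)..R, (t ^ 2 - 1) / (e ^ 3) ^ 2 * u t ^ 2 := by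
      refine intervalIntegral.integral_nonneg hR1 fun t ht => ?_
      have : 0 ≤ t ^ 2 - 1 := by nlinarith [ht.1]
      positivity
    have h1 : |u' 1| ≤ 2 * N := hlip 1 zero_le_one le_rfl
    have h2 : -(u 1 * u' 1) ≤ 2 * N * |u 1| := by
      refine (neg_le_abs _).trans ?_
      rw [abs_mul, mul_comm]
      gcongr
    have h3 : X ≤ 4 * e * N := by
      refine le_of_quadratic_system he he1 hN (a := |u 1|) ?_ ?_
      · rw [sq_abs]
        linarith [(abs_le.1 hcs1).1]
      · have h7 : u R * u' R ≤ (e ^ 3) ^ 2 * N ^ 2 := by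
          nlinarith only [sq_nonneg (u R - u' R), hRu, hRu']
        linarith [(abs_le.1 hcs2).2]
    rw [← hXsq]
    exact pow_le_pow_left₀ hX0 h3 2
  have hout : ∀ y, 1 ≤ y → |u y| ≤ 5 * N * e ^ 2 := by
    intro y hy
    obtain ⟨R, hyR, hRu, hRu', -⟩ := hfar y hy
    have hR1 := hy.trans hyR
    have hI1 : ∫ t in y..R, 2 * (u t * u' t) = u R ^ 2 - u y ^ 2 := by
      refine intervalIntegral.integral_eq_sub_of_hasDerivAt (f := fun t => u t ^ 2)
        (fun t _ => ?_) (Continuous.intervalIntegrable (by fun_prop) _ _)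
      exact ((hu t).pow 2).congr_deriv (by ring)
    rw [intervalIntegral.integral_const_mul] at hI1
    have hcs1 : |∫ t in y..R, u t * u' t| ≤ 2 * e ^ 3 * N * (4 * e * N) := by
      refine abs_le_of_sq_le_sq ?_ (by positivity)
      refine (sq_intervalIntegral_mul_le hyR cu cu').trans ?_
      rw [mul_pow _ (4 * e * N)]
      have hm : ∀ {w : ℝ → ℝ}, Continuous w →
          ∫ t in y..R, w t ^ 2 ≤ ∫ t in (1 : ℝ)..R, w t ^ 2 := fun cw =>
        intervalIntegral.integral_mono_interval hy hyR le_rfl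
          (Eventually.of_forall fun t => sq_nonneg _) ((cw.pow 2).intervalIntegrable _ _)
      exact mul_le_mul ((hm cu).trans (hL2 R hR1)) ((hm cu').trans (hmult R hR1 hRu hRu'))
        (intervalIntegral.integral_nonneg hyR fun x _ => sq_nonneg _) (by positivity)
    refine abs_le_of_sq_le_sq ?_ (by positivity)
    have h4 := (abs_le.1 hcs1).1
    have h5 : (e ^ 3) ^ 2 * N ^ 2 ≤ (N * e ^ 2) ^ 2 := by
      have : e ^ 2 ≤ 1 := pow_le_one₀ he.le he1
      nlinarith [sq_nonneg (N * e ^ 2)]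
    nlinarith [sq_nonneg (N * e ^ 2)]
  rcases le_total 1 x with h | h
  · refine (hout x h).trans ?_
    have : 0 ≤ max (1 - x ^ 2) 0 := le_max_right _ _
    nlinarith
  · have h1 : |u x - u 1| ≤ 2 * N * |x - 1| := by
      have := (convex_Icc (0 : ℝ) 1).norm_image_sub_le_of_norm_hasDerivWithin_le
        (f := u) (f' := u') (C := 2 * N) (fun y _ => (hu y).hasDerivWithinAt)
        (fun y hy => hlip y hy.1 hy.2) (right_mem_Icc.2 zero_le_one) ⟨hx, h⟩
      exact this
    rw [abs_sub_comm x 1, abs_of_nonneg (by linarith : (0 : ℝ) ≤ 1 - x)] at h1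
    have h2 := abs_sub_abs_le_abs_sub (u x) (u 1)
    have h3 := hout 1 le_rfl
    have h4 : 1 - x ≤ max (1 - x ^ 2) 0 := le_max_of_le_left (by nlinarith)
    nlinarith

lemma pFun_neg (ε x : ℝ) : pFun ε (-x) = pFun ε x := by
  simp only [pFun, indicator_outer_eq, neg_sq]

variable {𝕜 : Type*} [RCLike 𝕜]

/-- A solution of `-v'' + p_ε v = F`, with `ε = e³`, is `O(ε^{2/3} + (1 - x²)₊)`. -/
theorem norm_le_of_pFun_equation {v v' F : ℝ → 𝕜} {e N : ℝ} (he : 0 < e) (he1 : e ≤ 1)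
    (hN : 0 < N) (hF : Continuous F) (hv : ∀ x, HasDerivAt v (v' x) x)
    (hv' : ∀ x, HasDerivAt v' ((pFun (e ^ 3) x : 𝕜) * v x - F x) x)
    (iv : Integrable fun x => ‖v x‖ ^ 2) (iv' : Integrable fun x => ‖v' x‖ ^ 2)
    (ip : Integrable fun x => pFun (e ^ 3) x * ‖v x‖ ^ 2) (iF : Integrable fun x => ‖F x‖ ^ 2)
    (bv' : ∫ x, ‖v' x‖ ^ 2 ≤ N ^ 2) (bF : ∫ x, ‖F x‖ ^ 2 ≤ N ^ 2) (x : ℝ) :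
    ‖v x‖ ≤ 5 * N * (e ^ 2 + max (1 - x ^ 2) 0) := by
  have cv : Continuous v := continuous_iff_continuousAt.2 fun x => (hv x).continuousAt
  have cv' : Continuous v' := continuous_iff_continuousAt.2 fun x => (hv' x).continuousAt
  have cp := pFun_continuous (e ^ 3)
  -- It is enough to treat the real-valued solution `L ∘ v`, where `L` norms `v x`.
  obtain ⟨L, hL1, hLx⟩ := exists_dual_vector'' ℝ (v x)
  have hLn : ∀ z, ‖L z‖ ≤ ‖z‖ := fun z =>
    (L.le_opNorm z).trans (mul_le_of_le_one_left (norm_nonneg _) hL1)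
  have hLsq : ∀ z, L z ^ 2 ≤ ‖z‖ ^ 2 := fun z => by
    rw [← sq_abs]
    exact pow_le_pow_left₀ (abs_nonneg _) (hLn z) 2
  have hi : ∀ {w : ℝ → 𝕜}, Continuous w → (Integrable fun x => ‖w x‖ ^ 2) →
      Integrable fun x => L (w x) ^ 2 := fun cw hw =>
    hw.mono' (((L.continuous.comp cw).pow 2).aestronglyMeasurable)
      (Eventually.of_forall fun x => by
        rw [Real.norm_of_nonneg (sq_nonneg _)]
        exact hLsq _)
  have hd1 : ∀ x, HasDerivAt (fun x => L (v x)) (L (v' x)) x := fun x =>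
    L.hasFDerivAt.comp_hasDerivAt x (hv x)
  have hd2 : ∀ x, HasDerivAt (fun x => L (v' x)) (pFun (e ^ 3) x * L (v x) - L (F x)) x := by
    intro x
    refine (L.hasFDerivAt.comp_hasDerivAt x (hv' x)).congr_deriv ?_
    rw [map_sub, ← RCLike.real_smul_eq_coe_mul, map_smul, smul_eq_mul]
  have hip : Integrable fun x => pFun (e ^ 3) x * L (v x) ^ 2 :=
    ip.mono' ((cp.mul ((L.continuous.comp cv).pow 2)).aestronglyMeasurable)
      (Eventually.of_forall fun x => by
        rw [Real.norm_of_nonneg (mul_nonneg (pFun_nonneg _ _) (sq_nonneg _))]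
        exact mul_le_mul_of_nonneg_left (hLsq _) (pFun_nonneg _ _))
  have hb1 : ∫ x, L (v' x) ^ 2 ≤ N ^ 2 :=
    (integral_mono (hi cv' iv') iv' fun x => hLsq _).trans bv'
  have hb2 : ∫ x, L (F x) ^ 2 ≤ N ^ 2 :=
    (integral_mono (hi hF iF) iF fun x => hLsq _).trans bF
  have hLx' : |L (v x)| = ‖v x‖ := by
    rw [hLx]
    exact abs_of_nonneg (norm_nonneg (v x))
  rw [← hLx']
  rcases le_total 0 x with hx | hx
  · exact abs_le_of_pFun_equation_of_nonneg he he1 hN (L.continuous.comp hF) hd1 hd2 (hi cv iv)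
      (hi cv' iv') hip (hi hF iF) hb1 hb2 hx
  · have h := abs_le_of_pFun_equation_of_nonneg (u := fun x => L (v (-x)))
      (u' := fun x => -L (v' (-x))) (F := fun x => L (F (-x))) he he1 hN
      (L.continuous.comp (hF.comp continuous_neg))
      (fun x => by
        exact ((hd1 (-x)).scomp x (hasDerivAt_neg x)).congr_deriv (by simp))
      (fun x => by
        exact ((hd2 (-x)).scomp x (hasDerivAt_neg x)).neg.congr_deriv (by simp [pFun_neg]))
      (hi cv iv).comp_neg (by simpa using (hi cv' iv').comp_neg)
      (by simpa [pFun_neg] using hip.comp_neg) (hi hF iF).comp_neg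
      (by
        simp only [neg_sq]
        rwa [integral_neg_eq_self (fun x => L (v' x) ^ 2)])
      (by rwa [integral_neg_eq_self (fun x => L (F x) ^ 2)])
      (x := -x) (by linarith)
    simpa using h

end LminusEstimate

/-! ### The maximum principle and the estimates for the inverse of `L_+^ε` -/

section LplusEstimate

lemma not_isLocalMax_of_deriv2_pos {z z' : ℝ → ℝ} {x c : ℝ}
    (hz : ∀ᶠ y in 𝓝 x, HasDerivAt z (z' y) y)
    (hz' : HasDerivAt z' c x) (hc : 0 < c) : ¬IsLocalMax z x := by
  intro hmax
  have hd : deriv z =ᶠ[𝓝 x] z' := hz.mono fun y hy => hy.deriv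
  have hdd : deriv (deriv z) x = c := by rw [hd.deriv_eq, hz'.deriv]
  have hmin := isLocalMin_of_deriv_deriv_pos (hdd ▸ hc) hmax.deriv_eq_zero
    hz.self_of_nhds.continuousAt
  have hconst : z =ᶠ[𝓝 x] fun _ => z x := by
    filter_upwards [hmax, hmin] with y h1 h2 using le_antisymm h1 h2
  have h0 : deriv z =ᶠ[𝓝 x] fun _ => 0 := by
    have := hconst.deriv
    simpa using this
  rw [h0.deriv_eq, deriv_const] at hdd
  exact hc.ne hdd

/-- The maximum principle on a closed subset `T` of the line: a function that is asymptotically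
nonpositive, nonpositive on `T \ S`, and strictly convex at the points of the open set `S` where it
is positive, is nonpositive on `T`. -/
lemma nonpos_of_deriv2_pos {S T : Set ℝ} (hS : IsOpen S) (hST : S ⊆ T) (hT : IsClosed T)
    {z z' z'' : ℝ → ℝ} (hcont : ContinuousOn z T) (hz : ∀ x ∈ S, HasDerivAt z (z' x) x)
    (hz' : ∀ x ∈ S, HasDerivAt z' (z'' x) x)
    (hlim : ∀ η > 0, ∀ᶠ x in cocompact ℝ ⊓ 𝓟 T, z x ≤ η)
    (hbdry : ∀ x ∈ T \ S, z x ≤ 0) (hconv : ∀ x ∈ S, 0 < z x → 0 < z'' x) {x : ℝ} (hx : x ∈ T) :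
    z x ≤ 0 := by
  by_contra! hpos
  obtain ⟨y, hyT, hy⟩ := hcont.exists_isMaxOn' hT hx (hlim _ hpos)
  have hy0 : 0 < z y := hpos.trans_le (hy hx)
  have hyS : y ∈ S := by
    by_contra h
    exact (hbdry y ⟨hyT, h⟩).not_gt hy0
  have hnhds : S ∈ 𝓝 y := hS.mem_nhds hyS
  refine not_isLocalMax_of_deriv2_pos (eventually_of_mem hnhds hz) (hz' y hyS)
    (hconv y hyS hy0) ?_
  exact hy.isLocalMax (mem_of_superset hnhds hST)

lemma tendsto_cocompact_zero_of_integrable_sq {u u' : ℝ → ℝ} (hu : ∀ x, HasDerivAt u (u' x) x)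
    (cu' : Continuous u') (iu : Integrable fun x => u x ^ 2)
    (iu' : Integrable fun x => u' x ^ 2) : Tendsto u (cocompact ℝ) (𝓝 0) := by
  have cu : Continuous u := continuous_iff_continuousAt.2 fun x => (hu x).continuousAt
  have hd : ∀ x, HasDerivAt (fun x => u x ^ 2) (2 * u x * u' x) x := fun x =>
    ((hu x).pow 2).congr_deriv (by ring)
  have hi : Integrable fun x => 2 * u x * u' x := by
    refine (iu.add iu').mono' (by fun_prop) (Eventually.of_forall fun x => ?_)
    rw [Real.norm_eq_abs, abs_le, Pi.add_apply]
    constructor <;> nlinarith [sq_nonneg (u x - u' x), sq_nonneg (u x + u' x)]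
  have h1 : Tendsto (fun x => u x ^ 2) atTop (𝓝 0) :=
    tendsto_zero_of_hasDerivAt_of_integrableOn_Ioi (a := 0) (fun x _ => hd x) hi.integrableOn
      iu.integrableOn
  have h2 : Tendsto (fun x => u x ^ 2) atBot (𝓝 0) :=
    tendsto_zero_of_hasDerivAt_of_integrableOn_Iic (a := 0) (fun x _ => hd x) hi.integrableOn
      iu.integrableOn
  rw [cocompact_eq_atBot_atTop]
  have h3 := (Real.continuous_sqrt.tendsto 0).comp (h2.sup h1)
  rw [Real.sqrt_zero] at h3
  rw [tendsto_zero_iff_abs_tendsto_zero]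
  simpa [Function.comp_def, Real.sqrt_sq_eq_abs] using h3

lemma qFun_eq (ε x : ℝ) : qFun ε x = (max (2 * (1 - x ^ 2)) 0 + max (x ^ 2 - 1) 0) / ε ^ 2 := by
  rw [qFun, indicator_inner_eq, indicator_outer_eq]
  ring

lemma abs_div_le_qFun {ε x : ℝ} : |x ^ 2 - 1| / ε ^ 2 ≤ qFun ε x := by
  rw [qFun_eq]
  gcongr
  rcases le_total (x ^ 2) 1 with h | h
  · rw [abs_of_nonpos (by linarith)]
    linarith [le_max_left (2 * (1 - x ^ 2)) 0, le_max_right (x ^ 2 - 1) 0]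
  · rw [abs_of_nonneg (by linarith)]
    linarith [le_max_right (2 * (1 - x ^ 2)) 0, le_max_left (x ^ 2 - 1) 0]

lemma barrier_polynomial_bound {a t : ℝ} (ha : 0 ≤ a) (ha1 : a ≤ 1) :
    (2 - 100 * |t|) * (1 + t ^ 2) ^ 3 ≤
      4 * (1 + a * t) * (2 - 6 * t ^ 2) + 4 * a * t * (1 + t ^ 2) := by
  set r := |t| with hr
  have hr0 : 0 ≤ r := abs_nonneg t
  have ht : t ^ 2 = r ^ 2 := (sq_abs t).symm
  have hp : |a * t| ≤ r := by
    rw [abs_mul, abs_of_nonneg ha]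
    exact mul_le_of_le_one_left hr0 ha1
  have h1 : -(r * (12 + 20 * r ^ 2)) ≤ a * t * (12 - 20 * r ^ 2) := by
    refine neg_le_of_abs_le ?_
    rw [abs_mul]
    refine mul_le_mul hp ?_ (abs_nonneg _) hr0
    rw [abs_le]
    constructor <;> nlinarith [sq_nonneg r]
  have h2 : 0 ≤ 6 + 88 * r - 30 * r ^ 2 + 280 * r ^ 3 - 6 * r ^ 4 + 300 * r ^ 5 - 2 * r ^ 6 +
      100 * r ^ 7 := by
    have e1 : 0 ≤ r * (1 - r) ^ 2 := by positivity
    have e2 : 0 ≤ r ^ 3 * (1 - r) ^ 2 := by positivity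
    have e3 : 0 ≤ r ^ 5 * (1 - r) ^ 2 := by positivity
    have e4 : 0 ≤ r ^ 3 := by positivity
    have e5 : 0 ≤ r ^ 5 := by positivity
    have e6 : 0 ≤ r ^ 7 := by positivity
    linarith
  rw [ht]
  linarith

lemma hasDerivAt_scaled (a x : ℝ) : HasDerivAt (fun x : ℝ => (x ^ 2 - 1) / a) (2 * x / a) x :=
  (((hasDerivAt_pow 2 x).sub_const 1).div_const a).congr_deriv (by simp)

/-- The barrier `K ε² (102 + 1 / (1 + t²))`, where `t = (x² - 1) / ε^{2/3}` and `ε = e³`. The bump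
`1 / (1 + t²)` is strictly concave at the turning points, where `q_ε` vanishes. -/
lemma le_of_qFun_equation {u u' g : ℝ → ℝ} {e K : ℝ} (he : 0 < e) (he1 : e ≤ 1) (hK : 0 < K)
    (hu : ∀ x, HasDerivAt u (u' x) x)
    (hu' : ∀ x, HasDerivAt u' (qFun (e ^ 3) x * u x - g x) x)
    (hlim : Tendsto u (cocompact ℝ) (𝓝 0))
    (hg : ∀ x, |g x| ≤ K * (e ^ 2 + max (1 - x ^ 2) 0)) (x : ℝ) :
    u x ≤ 103 * K * e ^ 6 := by
  set t : ℝ → ℝ := fun x => (x ^ 2 - 1) / e ^ 2 with ht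
  have htx : ∀ x, x ^ 2 = 1 + e ^ 2 * t x := fun x => by
    rw [ht]
    field_simp
    ring
  have hs : ∀ x, 0 < 1 + t x ^ 2 := fun x => by positivity
  set b : ℝ → ℝ := fun x => K * e ^ 6 * (102 + 1 / (1 + t x ^ 2)) with hb
  set b' : ℝ → ℝ := fun x => -(4 * K * e ^ 4) * (x * t x / (1 + t x ^ 2) ^ 2) with hb'
  set b'' : ℝ → ℝ := fun x => K * e ^ 2 * ((4 * (1 + e ^ 2 * t x) * (6 * t x ^ 2 - 2) -
    4 * e ^ 2 * t x * (1 + t x ^ 2)) / (1 + t x ^ 2) ^ 3) with hb''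
  have hdt : ∀ x, HasDerivAt t (2 * x / e ^ 2) x := hasDerivAt_scaled (e ^ 2)
  have hds : ∀ x, HasDerivAt (fun x => 1 + t x ^ 2) (2 * t x * (2 * x / e ^ 2)) x := fun x =>
    (((hdt x).pow 2).const_add 1).congr_deriv (by simp)
  have hdb : ∀ x, HasDerivAt b (b' x) x := by
    intro x
    have h1 := ((((hds x).inv (hs x).ne').const_add 102).const_mul (K * e ^ 6))
    have hbb : b = fun x => K * e ^ 6 * (102 + (1 + t x ^ 2)⁻¹) := by
      funext y
      rw [hb]
      simp only [one_div]
    rw [hbb]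
    refine h1.congr_deriv ?_
    rw [hb']
    have := (hs x).ne'
    field_simp
    ring
  have hdb' : ∀ x, HasDerivAt b' (b'' x) x := by
    intro x
    have h1 := ((((hasDerivAt_id x).mul (hdt x)).div ((hds x).pow 2)
      (pow_ne_zero 2 (hs x).ne')).const_mul (-(4 * K * e ^ 4)))
    refine h1.congr_deriv ?_
    have hs' := (hs x).ne'
    simp only [hb'', id_eq, Pi.mul_apply, Pi.pow_apply, Nat.cast_ofNat]
    have hx2 := htx x
    set τ := t x
    field_simp
    ring_nf
    simp only [hx2]
    ring
  have hb0 : ∀ x, K * e ^ 6 * 102 ≤ b x := fun x => by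
    have : 0 ≤ 1 / (1 + t x ^ 2) := by positivity
    rw [hb]
    simp only
    gcongr
    linarith
  have hmain : u x - b x ≤ 0 := by
    refine nonpos_of_deriv2_pos (S := univ) (T := univ) isOpen_univ subset_rfl isClosed_univ
      (z := fun x => u x - b x) (z' := fun x => u' x - b' x)
      (z'' := fun x => (qFun (e ^ 3) x * u x - g x) - b'' x)
      (fun x _ => ((hu x).sub (hdb x)).continuousAt.continuousWithinAt)
      (fun x _ => (hu x).sub (hdb x)) (fun x _ => (hu' x).sub (hdb' x)) ?_ (by simp) ?_
      (mem_univ x)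
    · intro η hη
      rw [principal_univ, inf_top_eq]
      filter_upwards [hlim.eventually (gt_mem_nhds hη)] with x hx
      have h1 := hb0 x
      have h2 : 0 < K * e ^ 6 := by positivity
      linarith
    · intro x _ hx
      have hq := abs_div_le_qFun (ε := e ^ 3) (x := x)
      have hq0 := qFun_nonneg (e ^ 3) x
      have h1 : x ^ 2 - 1 = e ^ 2 * t x := by linarith [htx x]
      rw [h1, abs_mul, abs_of_pos (by positivity : 0 < e ^ 2)] at hq
      have h2 : K * e ^ 2 * (102 * |t x|) ≤ qFun (e ^ 3) x * u x := by
        calc K * e ^ 2 * (102 * |t x|) = e ^ 2 * |t x| / (e ^ 3) ^ 2 * (K * e ^ 6 * 102) := by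
              field_simp
          _ ≤ qFun (e ^ 3) x * (K * e ^ 6 * 102) := by gcongr
          _ ≤ qFun (e ^ 3) x * u x := by
              gcongr
              linarith [hb0 x]
      have h3 : g x ≤ K * e ^ 2 * (1 + |t x|) := by
        refine (le_abs_self _).trans ((hg x).trans ?_)
        have : max (1 - x ^ 2) 0 ≤ e ^ 2 * |t x| := by
          refine max_le ?_ (by positivity)
          nlinarith [neg_abs_le (t x), sq_nonneg e]
        nlinarith
      have h4 : b'' x ≤ K * e ^ 2 * (100 * |t x| - 2) := by
        rw [hb'']
        simp only
        refine mul_le_mul_of_nonneg_left ?_ (by positivity)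
        have h5 := barrier_polynomial_bound (a := e ^ 2) (t := t x) (by positivity)
          (pow_le_one₀ he.le he1)
        rw [div_le_iff₀ (pow_pos (hs x) 3)]
        linarith
      have h6 : 0 < K * e ^ 2 := by positivity
      nlinarith [abs_nonneg (t x)]
  have h1 : b x ≤ 103 * K * e ^ 6 := by
    have : 1 / (1 + t x ^ 2) ≤ 1 := by
      rw [div_le_one (hs x)]
      nlinarith [sq_nonneg (t x)]
    have h2 : 0 < K * e ^ 6 := by positivity
    rw [hb]
    simp only
    nlinarith
  linarith

/-- The barrier `1100 K ε² / (1 + t)` in the outer region, where `t = (x² - 1) / ε^{2/3}` and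
`ε = e³`. It is a supersolution for `t ≥ 9`; for `0 ≤ t ≤ 9` the global bound applies. -/
lemma le_div_of_qFun_equation {u u' g : ℝ → ℝ} {e K : ℝ} (he : 0 < e) (he1 : e ≤ 1) (hK : 0 < K)
    (hu : ∀ x, HasDerivAt u (u' x) x)
    (hu' : ∀ x, HasDerivAt u' (qFun (e ^ 3) x * u x - g x) x)
    (hlim : Tendsto u (cocompact ℝ) (𝓝 0))
    (hg : ∀ x, |g x| ≤ K * (e ^ 2 + max (1 - x ^ 2) 0)) {x : ℝ} (hx : 1 ≤ x ^ 2) :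
    u x ≤ 1100 * K * e ^ 6 / (1 + (x ^ 2 - 1) / e ^ 2) := by
  have hglob := le_of_qFun_equation he he1 hK hu hu' hlim hg
  set t : ℝ → ℝ := fun x => (x ^ 2 - 1) / e ^ 2 with ht
  have htx : ∀ x, x ^ 2 = 1 + e ^ 2 * t x := fun x => by
    rw [ht]
    field_simp
    ring
  have hKe : 0 < K * e ^ 6 := by positivity
  have hnear : ∀ x, 0 ≤ t x → t x ≤ 9 → u x ≤ 1100 * K * e ^ 6 / (1 + t x) := by
    intro x h0 h9
    refine (hglob x).trans ?_
    rw [le_div_iff₀ (by linarith)]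
    nlinarith
  have htc : Continuous t := by fun_prop
  have ht0 : 0 ≤ t x := div_nonneg (by linarith) (by positivity)
  rcases le_total (t x) 9 with h9 | h9
  · exact hnear x ht0 h9
  set b : ℝ → ℝ := fun x => 1100 * K * e ^ 6 * (1 + t x)⁻¹ with hb
  set b' : ℝ → ℝ := fun x => -(2200 * K * e ^ 4) * (x / (1 + t x) ^ 2) with hb'
  set b'' : ℝ → ℝ := fun x => 1100 * K * e ^ 2 * (8 * (1 + e ^ 2 * t x) / (1 + t x) ^ 3 -
    2 * e ^ 2 / (1 + t x) ^ 2) with hb''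
  have hdt : ∀ x, HasDerivAt t (2 * x / e ^ 2) x := hasDerivAt_scaled (e ^ 2)
  have hdb : ∀ x, 9 ≤ t x → HasDerivAt b (b' x) x := by
    intro x hx
    have hs : 1 + t x ≠ 0 := by linarith
    refine ((((hdt x).const_add 1).inv hs).const_mul (1100 * K * e ^ 6)).congr_deriv ?_
    rw [hb']
    field_simp
    ring
  have hdb' : ∀ x, 9 ≤ t x → HasDerivAt b' (b'' x) x := by
    intro x hx
    have hs : 1 + t x ≠ 0 := by linarith
    refine ((((hasDerivAt_id x).div (((hdt x).const_add 1).pow 2)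
      (pow_ne_zero 2 hs))).const_mul (-(2200 * K * e ^ 4))).congr_deriv ?_
    simp only [hb'', id_eq, Pi.pow_apply, Nat.cast_ofNat]
    have hx2 := htx x
    set τ := t x
    field_simp
    ring_nf
    simp only [hx2]
    ring
  have hmain : u x - b x ≤ 0 := by
    refine nonpos_of_deriv2_pos (S := {x | 9 < t x}) (T := {x | 9 ≤ t x})
      (isOpen_lt continuous_const htc) (fun x hx => show 9 ≤ t x from le_of_lt hx)
      (isClosed_le continuous_const htc)
      (z := fun x => u x - b x) (z' := fun x => u' x - b' x)
      (z'' := fun x => (qFun (e ^ 3) x * u x - g x) - b'' x)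
      (fun x hx => ((hu x).sub (hdb x hx)).continuousAt.continuousWithinAt)
      (fun x hx => (hu x).sub (hdb x (le_of_lt hx)))
      (fun x hx => (hu' x).sub (hdb' x (le_of_lt hx))) ?_ ?_ ?_ h9
    · intro η hη
      filter_upwards [(hlim.eventually (gt_mem_nhds hη)).filter_mono inf_le_left,
        mem_inf_of_right (mem_principal_self _)] with x hx hx9
      have h1 : 0 ≤ b x := by
        have : 0 ≤ 1 + t x := by linarith [show 9 ≤ t x from hx9]
        rw [hb]
        positivity
      linarith
    · rintro x ⟨hx1, hx2⟩
      have hx3 : 9 ≤ t x := hx1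
      have h := hnear x (by linarith) (not_lt.1 hx2)
      rw [hb]
      simp only
      rw [div_eq_mul_inv] at h
      linarith
    · intro x hx hpos
      have hx9 : 9 < t x := hx
      have hq := abs_div_le_qFun (ε := e ^ 3) (x := x)
      have hq0 := qFun_nonneg (e ^ 3) x
      have h1 : x ^ 2 - 1 = e ^ 2 * t x := by linarith [htx x]
      rw [h1, abs_of_nonneg (by positivity)] at hq
      have hs : 0 < 1 + t x := by linarith
      have hbx : 0 ≤ b x := by
        rw [hb]
        positivity
      have h2 : 1100 * K * e ^ 2 * (t x / (1 + t x)) ≤ qFun (e ^ 3) x * u x := by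
        calc 1100 * K * e ^ 2 * (t x / (1 + t x)) = e ^ 2 * t x / (e ^ 3) ^ 2 * b x := by
              rw [hb]
              field_simp
          _ ≤ qFun (e ^ 3) x * b x := by gcongr
          _ ≤ qFun (e ^ 3) x * u x := by
              gcongr
              linarith
      have h3 : g x ≤ K * e ^ 2 := by
        refine (le_abs_self _).trans ((hg x).trans ?_)
        rw [max_eq_right]
        · simp
        · have : 0 ≤ e ^ 2 * t x := by positivity
          linarith
      have h4 : b'' x ≤ 1100 * K * e ^ 2 * (8 / (1 + t x) ^ 2) := by
        rw [hb'']
        simp only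
        refine mul_le_mul_of_nonneg_left ?_ (by positivity)
        have h5 : 0 ≤ 2 * e ^ 2 / (1 + t x) ^ 2 := by positivity
        have h6 : 8 * (1 + e ^ 2 * t x) / (1 + t x) ^ 3 ≤ 8 / (1 + t x) ^ 2 := by
          rw [div_le_div_iff₀ (by positivity) (by positivity)]
          have h7 : e ^ 2 * t x ≤ t x := mul_le_of_le_one_left (by linarith)
            (pow_le_one₀ he.le he1)
          have h8 : 0 < (1 + t x) ^ 2 := by positivity
          nlinarith
        linarith
      have h5 : 8 / (1 + t x) ^ 2 ≤ 8 / 100 := by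
        gcongr
        nlinarith
      have h6 : 9 / 10 ≤ t x / (1 + t x) := by
        rw [div_le_div_iff₀ (by norm_num) hs]
        linarith
      have h7 : 0 < K * e ^ 2 := by positivity
      nlinarith
  rw [hb] at hmain
  simp only at hmain
  rw [div_eq_mul_inv]
  linarith

lemma qFun_mul_le_inner {e x y B : ℝ} (he : 0 < e) (hx : x ^ 2 ≤ 1) (hy : y ≤ B * e ^ 6) :
    qFun (e ^ 3) x * y ≤ 2 * B * (1 - x ^ 2) := by
  rw [qFun_eq, max_eq_left (by linarith), max_eq_right (by linarith), add_zero]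
  calc 2 * (1 - x ^ 2) / (e ^ 3) ^ 2 * y ≤ 2 * (1 - x ^ 2) / (e ^ 3) ^ 2 * (B * e ^ 6) := by
        have : 0 ≤ 1 - x ^ 2 := by linarith
        gcongr
    _ = 2 * B * (1 - x ^ 2) := by field_simp

lemma qFun_mul_le_outer {e x y B : ℝ} (he : 0 < e) (hB : 0 ≤ B) (hx : 1 ≤ x ^ 2)
    (hy : y ≤ B * e ^ 6 / (1 + (x ^ 2 - 1) / e ^ 2)) : qFun (e ^ 3) x * y ≤ B * e ^ 2 := by
  rw [qFun_eq, max_eq_right (by linarith), max_eq_left (by linarith), zero_add]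
  have h0 : 0 ≤ (x ^ 2 - 1) / e ^ 2 := div_nonneg (by linarith) (by positivity)
  calc (x ^ 2 - 1) / (e ^ 3) ^ 2 * y
      ≤ (x ^ 2 - 1) / (e ^ 3) ^ 2 * (B * e ^ 6 / (1 + (x ^ 2 - 1) / e ^ 2)) := by
        gcongr
    _ = B * e ^ 2 * ((x ^ 2 - 1) / e ^ 2 / (1 + (x ^ 2 - 1) / e ^ 2)) := by field_simp
    _ ≤ B * e ^ 2 * 1 := by
        gcongr
        rw [div_le_one (by linarith)]
        linarith
    _ = B * e ^ 2 := mul_one _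

variable {𝕜 : Type*} [RCLike 𝕜]

/-- Landau's interpolation inequality on the segment from `x` to `x + h`, for `h` of any sign. -/
lemma norm_deriv_mul_le {w w' w'' : ℝ → 𝕜} {x h A S : ℝ} (hw : ∀ y, HasDerivAt w (w' y) y)
    (hw' : ∀ y, HasDerivAt w' (w'' y) y) (hA : ∀ y, ‖w y‖ ≤ A)
    (hS : ∀ y ∈ uIcc x (x + h), ‖w'' y‖ ≤ S) : ‖w' x‖ * |h| ≤ 2 * A + S * h ^ 2 := by
  have hS0 : 0 ≤ S := (norm_nonneg _).trans (hS x left_mem_uIcc)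
  have hd : ∀ y ∈ uIcc x (x + h), ‖w' y - w' x‖ ≤ S * |h| := by
    intro y hy
    refine ((convex_uIcc x (x + h)).norm_image_sub_le_of_norm_hasDerivWithin_le
      (fun z _ => (hw' z).hasDerivWithinAt) hS left_mem_uIcc hy).trans ?_
    gcongr
    have := abs_sub_left_of_mem_uIcc hy
    simpa using this
  have h2 := (convex_uIcc x (x + h)).norm_image_sub_le_of_norm_hasDerivWithin_le
    (f := fun y => w y - (y : ℝ) • w' x) (f' := fun y => w' y - (1 : ℝ) • w' x) (C := S * |h|)
    (fun y _ => ((hw y).sub ((hasDerivAt_id y).smul_const (w' x))).hasDerivWithinAt)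
    (fun y hy => by simpa using hd y hy) left_mem_uIcc right_mem_uIcc
  have h3 : w (x + h) - (x + h) • w' x - (w x - x • w' x) = w (x + h) - w x - h • w' x := by
    rw [add_smul]
    abel
  rw [h3, add_sub_cancel_left, Real.norm_eq_abs, mul_assoc, abs_mul_abs_self] at h2
  have h4 : ‖h • w' x‖ ≤ ‖w (x + h) - w x‖ + ‖w (x + h) - w x - h • w' x‖ := by
    have := norm_sub_le (w (x + h) - w x) (w (x + h) - w x - h • w' x)
    rwa [sub_sub_cancel] at this
  rw [norm_smul, Real.norm_eq_abs, mul_comm] at h4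
  have h5 := norm_sub_le (w (x + h)) (w x)
  have h6 := hA x
  have h7 := hA (x + h)
  nlinarith

variable {w w' g : ℝ → 𝕜} {e K : ℝ}

/-- Pointwise bounds for the solution of `-w'' + q_ε w = g`, with `ε = e³`, when
`|g| ≤ K (ε^{2/3} + (1 - x²)₊)`. -/
theorem norm_le_of_qFun_equation (he : 0 < e) (he1 : e ≤ 1) (hK : 0 < K)
    (hw : ∀ x, HasDerivAt w (w' x) x)
    (hw' : ∀ x, HasDerivAt w' ((qFun (e ^ 3) x : 𝕜) * w x - g x) x)
    (iw : Integrable fun x => ‖w x‖ ^ 2) (iw' : Integrable fun x => ‖w' x‖ ^ 2)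
    (hgK : ∀ x, ‖g x‖ ≤ K * (e ^ 2 + max (1 - x ^ 2) 0)) (x : ℝ) :
    ‖w x‖ ≤ 1100 * K * e ^ 6 ∧
      (1 ≤ x ^ 2 → ‖w x‖ ≤ 1100 * K * e ^ 6 / (1 + (x ^ 2 - 1) / e ^ 2)) := by
  have cw : Continuous w := continuous_iff_continuousAt.2 fun x => (hw x).continuousAt
  have cw' : Continuous w' := continuous_iff_continuousAt.2 fun x => (hw' x).continuousAt
  -- It is enough to treat the real-valued solution `L ∘ w`, where `L` norms `w x`.
  obtain ⟨L, hL1, hLx⟩ := exists_dual_vector'' ℝ (w x)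
  have hLn : ∀ z, |L z| ≤ ‖z‖ := fun z =>
    (L.le_opNorm z).trans (mul_le_of_le_one_left (norm_nonneg _) hL1)
  have hi : ∀ {w : ℝ → 𝕜}, Continuous w → (Integrable fun x => ‖w x‖ ^ 2) →
      Integrable fun x => L (w x) ^ 2 := fun cw hw =>
    hw.mono' (((L.continuous.comp cw).pow 2).aestronglyMeasurable)
      (Eventually.of_forall fun x => by
        rw [Real.norm_of_nonneg (sq_nonneg _), ← sq_abs]
        exact pow_le_pow_left₀ (abs_nonneg _) (hLn _) 2)
  have hd1 : ∀ x, HasDerivAt (fun x => L (w x)) (L (w' x)) x := fun x =>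
    L.hasFDerivAt.comp_hasDerivAt x (hw x)
  have hd2 : ∀ x, HasDerivAt (fun x => L (w' x)) (qFun (e ^ 3) x * L (w x) - L (g x)) x := by
    intro x
    refine (L.hasFDerivAt.comp_hasDerivAt x (hw' x)).congr_deriv ?_
    rw [map_sub, ← RCLike.real_smul_eq_coe_mul, map_smul, smul_eq_mul]
  have hlim := tendsto_cocompact_zero_of_integrable_sq hd1 (L.continuous.comp cw') (hi cw iw)
    (hi cw' iw')
  have hgL : ∀ x, |L (g x)| ≤ K * (e ^ 2 + max (1 - x ^ 2) 0) := fun x =>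
    (hLn _).trans (hgK x)
  have hLx' : L (w x) = ‖w x‖ := hLx
  rw [← hLx']
  refine ⟨(le_of_qFun_equation he he1 hK hd1 hd2 hlim hgL x).trans ?_,
    le_div_of_qFun_equation he he1 hK hd1 hd2 hlim hgL⟩
  gcongr
  norm_num

/-- Near the edges, the interpolation inequality with step `ε μ^{-1/2}` bounds the derivative of
the solution of `-w'' + q_ε w = g`, where `ε = e³`. The step is taken away from the origin, where
the bound on `w''` improves. -/
theorem norm_deriv_le_of_qFun_equation (he : 0 < e) (he1 : e ≤ 1) (hK : 0 < K)
    (hw : ∀ x, HasDerivAt w (w' x) x)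
    (hw' : ∀ x, HasDerivAt w' ((qFun (e ^ 3) x : 𝕜) * w x - g x) x)
    (iw : Integrable fun x => ‖w x‖ ^ 2) (iw' : Integrable fun x => ‖w' x‖ ^ 2)
    (hgK : ∀ x, ‖g x‖ ≤ K * (e ^ 2 + max (1 - x ^ 2) 0)) {x μ : ℝ} (hμ : e ^ 2 ≤ μ)
    (hx : 1 - μ ≤ |x|) : ‖w' x‖ ≤ 9100 * K * (e ^ 3 * √μ) := by
  have hbound := norm_le_of_qFun_equation he he1 hK hw hw' iw iw' hgK
  have hμ0 : 0 < μ := (by positivity : 0 < e ^ 2).trans_le hμ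
  set m := √μ with hm
  have hm0 : 0 < m := Real.sqrt_pos.2 hμ0
  have hmsq : m ^ 2 = μ := Real.sq_sqrt hμ0.le
  have hsecond : ∀ y, |x| ≤ |y| → ‖(qFun (e ^ 3) y : 𝕜) * w y - g y‖ ≤ 6900 * K * μ := by
    intro y hy
    have h1 : max (1 - y ^ 2) 0 ≤ 2 * μ := by
      refine max_le ?_ (by positivity)
      rw [← sq_abs y]
      nlinarith [abs_nonneg y, sq_nonneg (1 - |y|)]
    have h2 := hgK y
    have h3 : ‖(qFun (e ^ 3) y : 𝕜) * w y‖ ≤ 3 * (1100 * K) * μ + 1100 * K * μ := by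
      rw [norm_mul, RCLike.norm_of_nonneg (qFun_nonneg _ _)]
      rcases le_total (y ^ 2) 1 with h | h
      · have h4 := qFun_mul_le_inner he h (hbound y).1
        have h5 := le_max_left (1 - y ^ 2) 0
        nlinarith
      · have h4 := qFun_mul_le_outer he (by positivity) h ((hbound y).2 h)
        nlinarith
    refine (norm_sub_le _ _).trans ?_
    nlinarith
  obtain ⟨h, habs, hh⟩ : ∃ h : ℝ, |h| = e ^ 3 / m ∧ ∀ y ∈ uIcc x (x + h), |x| ≤ |y| := by
    have hpos : 0 < e ^ 3 / m := by positivity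
    rcases le_total 0 x with hx0 | hx0
    · refine ⟨e ^ 3 / m, abs_of_pos hpos, fun y hy => ?_⟩
      rw [uIcc_of_le (by linarith)] at hy
      exact abs_le_abs_of_nonneg hx0 hy.1
    · refine ⟨-(e ^ 3 / m), by rw [abs_neg, abs_of_pos hpos], fun y hy => ?_⟩
      rw [uIcc_of_ge (by linarith)] at hy
      exact abs_le_abs_of_nonpos hx0 hy.2
  have hL := norm_deriv_mul_le hw hw' (fun y => (hbound y).1) fun y hy => hsecond y (hh y hy)
  rw [← sq_abs h, habs, mul_div_assoc', div_le_iff₀ hm0] at hL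
  have h1 : (2 * (1100 * K * e ^ 6) + 6900 * K * μ * (e ^ 3 / m) ^ 2) * m =
      9100 * K * (e ^ 3 * m) * e ^ 3 := by
    rw [← hmsq]
    field_simp
    ring
  rw [h1] at hL
  exact le_of_mul_le_mul_right hL (by positivity)

end LplusEstimate

/-! ### Coercivity of the forms -/

section Coercivity

variable {𝕜 : Type*} [RCLike 𝕜]

/-- Coercivity of the form, from `|φ' + x φ / 2|² ≥ 0`: the operator `-∂ₓ² + x² / 4` is bounded
below by `1 / 2`. -/
lemma coercive_of_le (V : C(ℝ, ℝ)) (hV : ∀ x, 0 ≤ V x) (hV' : ∀ x, (x ^ 2 - 1) / 4 ≤ V x)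
    (φ : testFunctions 𝕜) : 1 / 4 * ‖testToL2 𝕜 φ‖ ^ 2 ≤
      ‖testToL2 𝕜 (derivTest 𝕜 φ)‖ ^ 2 + ‖mulTest 𝕜 (sqrtPot V) φ‖ ^ 2 := by
  have e1 : ‖testToL2 𝕜 φ‖ ^ 2 = ∫ x, ‖(φ : ℝ → 𝕜) x‖ ^ 2 :=
    norm_toLp_sq (testFunctions.memLp φ)
  have e2 : ‖testToL2 𝕜 (derivTest 𝕜 φ)‖ ^ 2 = ∫ x, ‖(derivTest 𝕜 φ : ℝ → 𝕜) x‖ ^ 2 :=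
    norm_toLp_sq (testFunctions.memLp (derivTest 𝕜 φ))
  have e3 : ‖mulTest 𝕜 (sqrtPot V) φ‖ ^ 2 = ∫ x, V x * ‖(φ : ℝ → 𝕜) x‖ ^ 2 := by
    refine (norm_toLp_sq (testFunctions.memLp_mul 𝕜 (sqrtPot V) φ)).trans
      (integral_congr_ae (Eventually.of_forall fun x => ?_))
    simp only [norm_mul, mul_pow, RCLike.norm_ofReal, sq_abs]
    congr 1
    exact Real.sq_sqrt (hV x)
  set ψ : ℝ → 𝕜 := (φ : ℝ → 𝕜) with hψ
  set ψ' : ℝ → 𝕜 := (derivTest 𝕜 φ : ℝ → 𝕜) with hψ'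
  have cψ : Continuous ψ := φ.2.1.continuous
  have cψ' : Continuous ψ' := (derivTest 𝕜 φ).2.1.continuous
  have sψ : HasCompactSupport ψ := φ.2.2
  have sψ' : HasCompactSupport ψ' := (derivTest 𝕜 φ).2.2
  have snorm : HasCompactSupport fun x => ‖ψ x‖ ^ 2 :=
    sψ.comp_left (g := fun z : 𝕜 => ‖z‖ ^ 2) (by simp)
  have snorm' : HasCompactSupport fun x => ‖ψ' x‖ ^ 2 :=
    sψ'.comp_left (g := fun z : 𝕜 => ‖z‖ ^ 2) (by simp)
  have i1 : Integrable fun x => ‖ψ x‖ ^ 2 :=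
    (cψ.norm.pow 2).integrable_of_hasCompactSupport snorm
  have i2 : Integrable fun x => ‖ψ' x‖ ^ 2 :=
    (cψ'.norm.pow 2).integrable_of_hasCompactSupport snorm'
  have i3 : Integrable fun x => V x * ‖ψ x‖ ^ 2 :=
    (V.continuous.mul (cψ.norm.pow 2)).integrable_of_hasCompactSupport snorm.mul_left
  have hd : ∀ x, HasDerivAt (fun x : ℝ => x / 2 * ‖ψ x‖ ^ 2)
      (1 / 2 * ‖ψ x‖ ^ 2 + x * inner ℝ (ψ x) (ψ' x)) x := fun x =>
    (((hasDerivAt_id x).div_const 2).mul ((testFunctions.hasDerivAt φ x).norm_sq)).congr_deriv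
      (by simp only [id_eq]; ring)
  have i4 : Integrable fun x : ℝ => x / 2 * ‖ψ x‖ ^ 2 :=
    ((continuous_id.div_const 2).mul (cψ.norm.pow 2)).integrable_of_hasCompactSupport
      snorm.mul_left
  have i5 : Integrable fun x : ℝ => 1 / 2 * ‖ψ x‖ ^ 2 + x * inner ℝ (ψ x) (ψ' x) := by
    refine (i1.const_mul (1 / 2)).add (Continuous.integrable_of_hasCompactSupport
      (continuous_id.mul (cψ.inner cψ')) (HasCompactSupport.mul_left ?_))
    refine sψ.mono fun x hx => ?_
    contrapose! hx
    simp [Function.notMem_support.1 hx]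
  have h0 := integral_eq_zero_of_hasDerivAt_of_integrable hd i5 i4
  have i23 : Integrable fun x => ‖ψ' x‖ ^ 2 + V x * ‖ψ x‖ ^ 2 := i2.add i3
  rw [e1, e2, e3, ← integral_add i2 i3, ← integral_const_mul, ← add_zero (∫ x, _ + _), ← h0,
    ← integral_add i23 i5]
  refine integral_mono (i1.const_mul _) (i23.add i5) fun x => ?_
  simp only
  have h1 := hV' x
  have h2 : ‖ψ' x + (x / 2) • ψ x‖ ^ 2 = ‖ψ' x‖ ^ 2 + x * inner ℝ (ψ x) (ψ' x) +
      (x / 2) ^ 2 * ‖ψ x‖ ^ 2 := by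
    rw [norm_add_sq_real, inner_smul_right, norm_smul, mul_pow, Real.norm_eq_abs, sq_abs,
      real_inner_comm]
    ring
  have h3 := sq_nonneg ‖ψ' x + (x / 2) • ψ x‖
  nlinarith [sq_nonneg ‖ψ x‖]

lemma le_pFun {ε : ℝ} (hε : 0 < ε) (hε1 : ε ≤ 1) (x : ℝ) : (x ^ 2 - 1) / 4 ≤ pFun ε x := by
  rw [pFun, indicator_outer_eq]
  have h1 : 1 ≤ 1 / ε ^ 2 := by
    rw [le_div_iff₀ (by positivity), one_mul]
    exact pow_le_one₀ hε.le hε1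
  have h2 := le_max_left (x ^ 2 - 1) 0
  have h3 := le_max_right (x ^ 2 - 1) 0
  nlinarith

lemma le_qFun {ε : ℝ} (hε : 0 < ε) (hε1 : ε ≤ 1) (x : ℝ) : (x ^ 2 - 1) / 4 ≤ qFun ε x := by
  refine (le_pFun hε hε1 x).trans ?_
  rw [pFun, qFun, mul_add]
  have : 0 ≤ 1 / ε ^ 2 * {y : ℝ | |y| < 1}.indicator (fun y => 2 * (1 - y ^ 2)) x := by
    rw [indicator_inner_eq]
    positivity
  linarith

end Coercivity

/-! ### Bounds for the composition of the inverses -/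

section Bounds

variable {𝕜 : Type*} [RCLike 𝕜]

lemma L2.norm_sq_eq (u : L2 𝕜) : ‖u‖ ^ 2 = ∫ x, ‖u x‖ ^ 2 := by
  conv_lhs => rw [← Lp.toLp_coeFn u (Lp.memLp u)]
  exact norm_toLp_sq _

lemma L2.integrable_norm_sq (u : L2 𝕜) : Integrable fun x => ‖u x‖ ^ 2 :=
  (Lp.memLp u).integrable_norm_pow (by norm_num)

/-- Weighted pointwise bounds of a bounded operator extend from test functions to `L²(ℝ)`. -/
lemma ae_norm_le_of_testFunctions (T : L2 𝕜 →L[𝕜] L2 𝕜) (S : Set ℝ) (β : ℝ → ℝ)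
    (h : ∀ φ : testFunctions 𝕜, ∀ᵐ x, x ∈ S → ‖T (testToL2 𝕜 φ) x‖ ≤ β x * ‖testToL2 𝕜 φ‖)
    (f : L2 𝕜) : ∀ᵐ x, x ∈ S → ‖T f x‖ ≤ β x * ‖f‖ := by
  obtain ⟨s, hs, hlim⟩ := mem_closure_iff_seq_limit.1 (dense_range_testToL2 (𝕜 := 𝕜) f)
  choose φ hφ using hs
  have hT : Tendsto (fun n => T (s n)) atTop (𝓝 (T f)) := (T.continuous.tendsto f).comp hlim
  obtain ⟨ns, hns, hae⟩ := (tendstoInMeasure_of_tendsto_Lp hT).exists_seq_tendsto_ae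
  have hall : ∀ᵐ x, ∀ n, x ∈ S → ‖T (s n) x‖ ≤ β x * ‖s n‖ := by
    rw [ae_all_iff]
    intro n
    rw [← hφ]
    exact h (φ n)
  filter_upwards [hae, hall] with x h1 h2 hx
  exact le_of_tendsto_of_tendsto h1.norm
    (((hlim.comp hns.tendsto_atTop).norm).const_mul (β x))
    (Eventually.of_forall fun n => h2 (ns n) hx)

/-- Pointwise and energy bounds for the composition of the two inverses, with `ε = e³`. -/
theorem exists_inverses_with_bounds {e : ℝ} (he : 0 < e) (he1 : e ≤ 1) :
    ∃ Gminus Gplus D : L2 𝕜 →L[𝕜] L2 𝕜, IsBoundedInverse (Lminus 𝕜 (e ^ 3)) Gminus ∧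
      IsBoundedInverse (Lplus 𝕜 (e ^ 3)) Gplus ∧
      (∀ f, IsWeakDeriv (Gplus (Gminus f)) (D f)) ∧
      (∀ f, ‖D f‖ ^ 2 ≤ ‖Gplus (Gminus f)‖ * (4 * ‖f‖)) ∧
      (∀ f, ∀ᵐ x, ‖Gplus (Gminus f) x‖ ≤ 11000 * e ^ 6 * ‖f‖) ∧
      (∀ f, ∀ᵐ x, 1 < |x| →
        ‖Gplus (Gminus f) x‖ ≤ 11000 * e ^ 6 / (1 + (x ^ 2 - 1) / e ^ 2) * ‖f‖) ∧
      (∀ μ, e ^ 2 ≤ μ → ∀ f, ∀ᵐ x, 1 - μ < |x| → ‖D f x‖ ≤ 91000 * (e ^ 3 * √μ) * ‖f‖) := by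
  have hε : 0 < e ^ 3 := by positivity
  have hε1 : e ^ 3 ≤ 1 := pow_le_one₀ he.le he1
  obtain ⟨G₁, D₁, R₁, hinv₁, hD₁, hR₁, hf₁, hen₁, hco₁⟩ := exists_isBoundedInverse (𝕜 := 𝕜)
    ⟨pFun (e ^ 3), pFun_continuous _⟩ (pFun_nonneg _) (c := 1 / 4) (by norm_num)
    (coercive_of_le _ (pFun_nonneg _) (le_pFun hε hε1))
  obtain ⟨G₂, D₂, R₂, hinv₂, hD₂, hR₂, hf₂, hen₂, hco₂⟩ := exists_isBoundedInverse (𝕜 := 𝕜)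
    ⟨qFun (e ^ 3), qFun_continuous _⟩ (qFun_nonneg _) (c := 1 / 4) (by norm_num)
    (coercive_of_le _ (qFun_nonneg _) (le_qFun hε hε1))
  have hG₁ : ∀ f, ‖G₁ f‖ ≤ 4 * ‖f‖ := by
    intro f
    have h1 := (hco₁ f).trans (hen₁ f)
    by_contra! h
    nlinarith [norm_nonneg f, norm_nonneg (G₁ f)]
  -- For a test function `φ` both equations have classical solutions.
  have key : ∀ φ : testFunctions 𝕜,
      (∀ᵐ x, ‖G₂ (G₁ (testToL2 𝕜 φ)) x‖ ≤ 11000 * e ^ 6 * ‖testToL2 𝕜 φ‖) ∧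
      (∀ᵐ x, 1 < |x| → ‖G₂ (G₁ (testToL2 𝕜 φ)) x‖ ≤
        11000 * e ^ 6 / (1 + (x ^ 2 - 1) / e ^ 2) * ‖testToL2 𝕜 φ‖) ∧
      (∀ μ, e ^ 2 ≤ μ → ∀ᵐ x, 1 - μ < |x| →
        ‖D₂ (G₁ (testToL2 𝕜 φ)) x‖ ≤ 91000 * (e ^ 3 * √μ) * ‖testToL2 𝕜 φ‖) := by
    intro φ
    set f := testToL2 𝕜 φ with hf
    rcases eq_or_ne f 0 with h0 | h0
    · rw [h0]
      simp only [map_zero, norm_zero, mul_zero]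
      have hz : ∀ᵐ x, ‖(0 : L2 𝕜) x‖ ≤ 0 := (Lp.coeFn_zero 𝕜 2 volume).mono fun x hx => by
        rw [hx]
        simp
      exact ⟨hz, hz.mono fun x hx _ => hx, fun _ _ => hz.mono fun x hx _ => hx⟩
    have hfpos : 0 < ‖f‖ := norm_pos_iff.2 h0
    obtain ⟨v, v', hv, hv', hdv, hdv', hRv⟩ := exists_classical_solution _ (pFun_nonneg _)
      (G₁ f) (D₁ f) (R₁ f) f (hD₁ f) (hR₁ f) (hf₁ f) φ.2.1.continuous (testToL2_coeFn φ)
    have cv : Continuous v := continuous_iff_continuousAt.2 fun x => (hdv x).continuousAt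
    obtain ⟨w, w', hw, hw', hdw, hdw', -⟩ := exists_classical_solution _ (qFun_nonneg _)
      (G₂ (G₁ f)) (D₂ (G₁ f)) (R₂ (G₁ f)) (G₁ f) (hD₂ _) (hR₂ _) (hf₂ _) cv hv
    have hint : ∀ {u : L2 𝕜} {z : ℝ → 𝕜}, u =ᵐ[volume] z → Integrable fun x => ‖z x‖ ^ 2 :=
      fun {u z} huz => (L2.integrable_norm_sq u).congr (huz.mono fun x hx => by simp only [hx])
    have hnorm : ∀ {u : L2 𝕜} {z : ℝ → 𝕜}, u =ᵐ[volume] z → ∫ x, ‖z x‖ ^ 2 = ‖u‖ ^ 2 :=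
      fun {u z} huz => by
        rw [L2.norm_sq_eq]
        exact integral_congr_ae (huz.mono fun x hx => by simp only [hx])
    have hvbound := norm_le_of_pFun_equation (N := 2 * ‖f‖) he he1 (by positivity)
      φ.2.1.continuous hdv hdv' (hint hv) (hint hv')
      ((hint hRv).congr (Eventually.of_forall fun x => by
        simp only [norm_mul, mul_pow, RCLike.norm_ofReal, sq_abs]
        congr 1
        exact Real.sq_sqrt (pFun_nonneg _ _)))
      (hint (testToL2_coeFn φ))
      (by
        rw [hnorm hv']
        have h1 := hen₁ f
        have h2 := hG₁ f
        nlinarith [sq_nonneg ‖R₁ f‖, norm_nonneg f])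
      (by
        rw [hnorm (testToL2_coeFn φ)]
        nlinarith [sq_nonneg ‖f‖])
    have hwbound := norm_le_of_qFun_equation (K := 5 * (2 * ‖f‖)) he he1 (by positivity) hdw hdw'
      (hint hw) (hint hw') hvbound
    refine ⟨?_, ?_, fun μ hμ => ?_⟩
    · filter_upwards [hw] with x hx
      rw [hx]
      exact (hwbound x).1.trans_eq (by ring)
    · filter_upwards [hw] with x hx hx1
      rw [hx]
      exact ((hwbound x).2 (by nlinarith [sq_abs x])).trans_eq (by ring)
    · filter_upwards [hw'] with x hx hx1
      rw [hx]
      exact (norm_deriv_le_of_qFun_equation he he1 (by positivity) hdw hdw' (hint hw) (hint hw')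
        hvbound hμ hx1.le).trans_eq (by ring)
  refine ⟨G₁, G₂, D₂ ∘L G₁, hinv₁, hinv₂, fun f => isWeakDeriv_of_inner (hD₂ (G₁ f)),
    fun f => ?_, fun f => ?_, fun f => ?_, fun μ hμ f => ?_⟩
  · have h1 := hen₂ (G₁ f)
    have h2 : ‖G₂ (G₁ f)‖ * ‖G₁ f‖ ≤ ‖G₂ (G₁ f)‖ * (4 * ‖f‖) := by
      gcongr
      exact hG₁ f
    change ‖D₂ (G₁ f)‖ ^ 2 ≤ _
    linarith [sq_nonneg ‖R₂ (G₁ f)‖]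
  · have := ae_norm_le_of_testFunctions (G₂ ∘L G₁) univ (fun _ => 11000 * e ^ 6)
      (fun φ => (key φ).1.mono fun x hx _ => hx) f
    exact this.mono fun x hx => hx (mem_univ x)
  · exact ae_norm_le_of_testFunctions (G₂ ∘L G₁) {x | 1 < |x|}
      (fun x => 11000 * e ^ 6 / (1 + (x ^ 2 - 1) / e ^ 2)) (fun φ => (key φ).2.1) f
  · exact ae_norm_le_of_testFunctions (D₂ ∘L G₁) {x | 1 - μ < |x|}
      (fun x => 91000 * (e ^ 3 * √μ)) (fun φ => (key φ).2.2 μ hμ) f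

end Bounds

/-! ### Operator norms from pointwise bounds -/

section OperatorNorms

variable {𝕜 : Type*} [RCLike 𝕜]

lemma opNorm_le_of_forall {p : ℝ≥0∞} {T : L2 𝕜 → ℝ → 𝕜} {B : ℝ} (hB : 0 ≤ B)
    (h : ∀ f, eLpNorm (T f) p volume ≤ ENNReal.ofReal (B * ‖f‖)) :
    opNorm p T ≤ ENNReal.ofReal B := by
  refine iSup₂_le fun f hf => ?_
  rw [ENNReal.div_le_iff (by simpa using hf) (by simp)]
  refine (h f).trans_eq ?_
  rw [ENNReal.ofReal_mul hB, ofReal_norm]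

lemma eLpNorm_two_le_of_sq_le {h : ℝ → 𝕜} {k : ℝ → ℝ} {M : ℝ} (hM : 0 ≤ M)
    (hle : ∀ᵐ x, ‖h x‖ ^ 2 ≤ k x) (hk : Integrable k) (hkM : ∫ x, k x ≤ M ^ 2) :
    eLpNorm h 2 volume ≤ ENNReal.ofReal M := by
  rw [eLpNorm_eq_lintegral_rpow_enorm_toReal (by norm_num) (by norm_num), ENNReal.toReal_ofNat]
  have h1 : ∫⁻ x, ‖h x‖ₑ ^ (2 : ℝ) ≤ ENNReal.ofReal M ^ (2 : ℝ) := by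
    calc ∫⁻ x, ‖h x‖ₑ ^ (2 : ℝ) ≤ ∫⁻ x, ENNReal.ofReal (k x) := by
          refine lintegral_mono_ae (hle.mono fun x hx => ?_)
          rw [ENNReal.rpow_ofNat, ← ofReal_norm, ← ENNReal.ofReal_pow (norm_nonneg _)]
          exact ENNReal.ofReal_le_ofReal hx
      _ = ENNReal.ofReal (∫ x, k x) :=
          (ofReal_integral_eq_lintegral_ofReal hk
            (hle.mono fun x hx => (sq_nonneg _).trans hx)).symm
      _ ≤ ENNReal.ofReal (M ^ 2) := ENNReal.ofReal_le_ofReal hkM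
      _ = ENNReal.ofReal M ^ (2 : ℝ) := by
          rw [ENNReal.rpow_ofNat, ENNReal.ofReal_pow hM]
  calc (∫⁻ x, ‖h x‖ₑ ^ (2 : ℝ)) ^ (1 / (2 : ℝ)) ≤
        (ENNReal.ofReal M ^ (2 : ℝ)) ^ (1 / (2 : ℝ)) := by
        gcongr
    _ = ENNReal.ofReal M := by
        rw [← ENNReal.rpow_mul]
        norm_num

/-- The profile dominating `1 / (1 + t)²` for `|x| > 1`, where `t = (x² - 1) / a`. -/
noncomputable def edgeProfile (a x : ℝ) : ℝ :=
  (1 + ((x - 1) / a) ^ 2)⁻¹ + (1 + ((x + 1) / a) ^ 2)⁻¹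

lemma integrable_edgeProfile {a : ℝ} (ha : 0 < a) : Integrable (edgeProfile a) := by
  have h := integrable_inv_one_add_sq.comp_div ha.ne'
  exact (h.comp_sub_right 1).add (h.comp_add_right 1)

lemma integral_edgeProfile {a : ℝ} (ha : 0 < a) : ∫ x, edgeProfile a x = 2 * Real.pi * a := by
  have h := integrable_inv_one_add_sq.comp_div ha.ne'
  have hv : ∫ x : ℝ, (1 + (x / a) ^ 2)⁻¹ = a * Real.pi := by
    rw [Measure.integral_comp_div (fun x : ℝ => (1 + x ^ 2)⁻¹), integral_univ_inv_one_add_sq,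
      abs_of_pos ha, smul_eq_mul]
  have h1 : ∫ x : ℝ, (1 + ((x - 1) / a) ^ 2)⁻¹ = a * Real.pi := by
    rw [← hv]
    exact integral_sub_right_eq_self (fun x : ℝ => (1 + (x / a) ^ 2)⁻¹) 1
  have h2 : ∫ x : ℝ, (1 + ((x + 1) / a) ^ 2)⁻¹ = a * Real.pi := by
    rw [← hv]
    exact integral_add_right_eq_self (fun x : ℝ => (1 + (x / a) ^ 2)⁻¹) 1
  simp only [edgeProfile]
  rw [integral_add (h.comp_sub_right 1) (h.comp_add_right 1), h1, h2]
  ring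

lemma edgeProfile_nonneg (a x : ℝ) : 0 ≤ edgeProfile a x := by
  rw [edgeProfile]
  positivity

lemma inv_sq_le_edgeProfile {a x : ℝ} (ha : 0 < a) (hx : 1 < |x|) :
    ((1 + (x ^ 2 - 1) / a)⁻¹) ^ 2 ≤ edgeProfile a x := by
  have main : ∀ s : ℝ, |s| ≤ x ^ 2 - 1 →
      ((1 + (x ^ 2 - 1) / a)⁻¹) ^ 2 ≤ (1 + (s / a) ^ 2)⁻¹ := by
    intro s hs
    rw [inv_pow]
    refine inv_anti₀ (by positivity) ?_
    have h1 : (s / a) ^ 2 ≤ ((x ^ 2 - 1) / a) ^ 2 := by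
      rw [← sq_abs, abs_div, abs_of_pos ha]
      gcongr
    have h2 : 0 ≤ (x ^ 2 - 1) / a := div_nonneg ((abs_nonneg _).trans hs) ha.le
    nlinarith
  rw [edgeProfile]
  rcases lt_abs.1 hx with h | h
  · refine (main (x - 1) ?_).trans (le_add_of_nonneg_right (by positivity))
    rw [abs_of_pos (by linarith)]
    nlinarith
  · refine (main (x + 1) ?_).trans (le_add_of_nonneg_left (by positivity))
    rw [abs_of_neg (by linarith)]
    nlinarith

/-- The decay away from the edges, at the scale `e²`, gives a factor `e` in the outer `L²` norm. -/
lemma eLpNorm_outer_le {w : ℝ → 𝕜} {B e : ℝ} (hB : 0 ≤ B) (he : 0 < e)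
    (hw : ∀ᵐ x, 1 < |x| → ‖w x‖ ≤ B / (1 + (x ^ 2 - 1) / e ^ 2)) :
    eLpNorm ({x : ℝ | 1 < |x|}.indicator w) 2 volume ≤ ENNReal.ofReal (3 * e * B) := by
  have he2 : 0 < e ^ 2 := by positivity
  refine eLpNorm_two_le_of_sq_le (k := fun x => B ^ 2 * edgeProfile (e ^ 2) x) (by positivity)
    ?_ ((integrable_edgeProfile he2).const_mul _) ?_
  · filter_upwards [hw] with x hx
    by_cases h : 1 < |x|
    · rw [indicator_of_mem (show x ∈ {x : ℝ | 1 < |x|} from h)]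
      refine (pow_le_pow_left₀ (norm_nonneg _) (hx h) 2).trans ?_
      rw [div_eq_mul_inv, mul_pow]
      gcongr
      exact inv_sq_le_edgeProfile he2 h
    · rw [indicator_of_notMem (show x ∉ {x : ℝ | 1 < |x|} from h)]
      have := edgeProfile_nonneg (e ^ 2) x
      rw [norm_zero, zero_pow two_ne_zero]
      positivity
  · rw [integral_const_mul, integral_edgeProfile he2]
    have := Real.pi_lt_d2
    have h1 : 0 ≤ B ^ 2 * e ^ 2 := by positivity
    nlinarith

lemma eLpNorm_two_le_of_edge_decay {w : ℝ → 𝕜} {B e : ℝ} (hB : 0 ≤ B) (he : 0 < e) (he1 : e ≤ 1)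
    (hw : ∀ᵐ x, ‖w x‖ ≤ B) (hw' : ∀ᵐ x, 1 < |x| → ‖w x‖ ≤ B / (1 + (x ^ 2 - 1) / e ^ 2)) :
    eLpNorm w 2 volume ≤ ENNReal.ofReal (3 * B) := by
  have he2 : 0 < e ^ 2 := by positivity
  have hi : Integrable ((Icc (-1 : ℝ) 1).indicator fun _ => (1 : ℝ)) :=
    (integrable_indicator_iff measurableSet_Icc).2 (by simp)
  refine eLpNorm_two_le_of_sq_le
    (k := fun x => B ^ 2 * ((Icc (-1 : ℝ) 1).indicator (fun _ => (1 : ℝ)) x +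
      edgeProfile (e ^ 2) x)) (by positivity)
    ?_ ((hi.add (integrable_edgeProfile he2)).const_mul _) ?_
  · filter_upwards [hw, hw'] with x hx hx'
    by_cases h : 1 < |x|
    · refine (pow_le_pow_left₀ (norm_nonneg _) (hx' h) 2).trans ?_
      rw [div_eq_mul_inv, mul_pow]
      have h0 : 0 ≤ (Icc (-1 : ℝ) 1).indicator (fun _ => (1 : ℝ)) x :=
        indicator_nonneg (fun _ _ => zero_le_one) x
      gcongr
      linarith [inv_sq_le_edgeProfile he2 h]
    · rw [indicator_of_mem (show x ∈ Icc (-1 : ℝ) 1 from abs_le.1 (not_lt.1 h))]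
      have := edgeProfile_nonneg (e ^ 2) x
      nlinarith [pow_le_pow_left₀ (norm_nonneg _) hx 2, sq_nonneg B]
  · rw [integral_const_mul, integral_add hi (integrable_edgeProfile he2),
      integral_edgeProfile he2, integral_indicator measurableSet_Icc]
    have h1 := Real.pi_lt_d2
    have h2 : e ^ 2 ≤ 1 := pow_le_one₀ he.le he1
    have h3 : Real.pi * e ^ 2 ≤ 3.15 := by nlinarith [Real.pi_pos]
    simp only [integral_const, measureReal_restrict_apply_univ, Real.volume_real_Icc, smul_eq_mul]
    norm_num
    nlinarith [sq_nonneg B]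

lemma eLpNorm_top_indicator_le {h : ℝ → 𝕜} {S : Set ℝ} {M : ℝ} (hM : 0 ≤ M)
    (hle : ∀ᵐ x, x ∈ S → ‖h x‖ ≤ M) : eLpNorm (S.indicator h) ⊤ volume ≤ ENNReal.ofReal M := by
  rw [eLpNorm_exponent_top]
  refine eLpNormEssSup_le_of_ae_bound (hle.mono fun x hx => ?_)
  by_cases hxS : x ∈ S
  · rw [indicator_of_mem hxS]
    exact hx hxS
  · rw [indicator_of_notMem hxS, norm_zero]
    exact hM

end OperatorNorms

/-! ### Exponents -/

section Exponents

lemma rpow_third_pow {ε : ℝ} (hε : 0 < ε) (n : ℕ) : (ε ^ (1 / 3 : ℝ)) ^ n = ε ^ ((n : ℝ) / 3) := by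
  rw [← Real.rpow_natCast, ← Real.rpow_mul hε.le]
  congr 1
  ring

/-- With `μ = max (ε^α) (ε^{2/3})`, the bound `ε √μ` for the derivative is at least as strong as
the exponent `min (4/3) (1/3 + 3 α / 2)`. -/
lemma mul_sqrt_max_extPow_le {ε : ℝ} (hε : 0 < ε) (hε1 : ε ≤ 1) (α : ℝ≥0∞) :
    ε * √(max (extPow ε α) (ε ^ (2 / 3 : ℝ))) ≤
      ε ^ (min (4 / 3 : ℝ≥0∞) (1 / 3 + 3 * α / 2)).toReal := by
  have hsqrt : ∀ s : ℝ, ε * √(ε ^ s) = ε ^ (1 + s / 2) := by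
    intro s
    rw [Real.sqrt_eq_rpow, ← Real.rpow_mul hε.le, Real.rpow_add hε, Real.rpow_one]
    congr 2
    ring
  have h43 : (min (4 / 3 : ℝ≥0∞) (1 / 3 + 3 * α / 2)).toReal ≤ 4 / 3 := by
    have htop : (4 / 3 : ℝ≥0∞) ≠ ⊤ := ENNReal.div_ne_top (by simp) (by simp)
    refine (ENNReal.toReal_mono htop (min_le_left _ _)).trans_eq ?_
    simp
  have hedge : extPow ε α ≤ ε ^ (2 / 3 : ℝ) → ε * √(max (extPow ε α) (ε ^ (2 / 3 : ℝ))) ≤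
      ε ^ (min (4 / 3 : ℝ≥0∞) (1 / 3 + 3 * α / 2)).toReal := by
    intro h
    rw [max_eq_right h, hsqrt]
    refine Real.rpow_le_rpow_of_exponent_ge hε hε1 (h43.trans ?_)
    norm_num
  by_cases hα : α = ⊤
  · refine hedge ?_
    rw [extPow, if_pos hα]
    positivity
  rcases le_total (2 / 3) α.toReal with h | h
  · refine hedge ?_
    rw [extPow, if_neg hα]
    exact Real.rpow_le_rpow_of_exponent_ge hε hε1 h
  · have h1 : ε ^ (2 / 3 : ℝ) ≤ extPow ε α := by
      rw [extPow, if_neg hα]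
      exact Real.rpow_le_rpow_of_exponent_ge hε hε1 h
    rw [max_eq_left h1, extPow, if_neg hα, hsqrt]
    refine Real.rpow_le_rpow_of_exponent_ge hε hε1 ?_
    have h13 : (1 / 3 : ℝ≥0∞) ≠ ⊤ := ENNReal.div_ne_top (by simp) (by simp)
    have h32 : 3 * α / 2 ≠ ⊤ := ENNReal.div_ne_top (ENNReal.mul_ne_top (by simp) hα) (by simp)
    have h2 : (min (4 / 3 : ℝ≥0∞) (1 / 3 + 3 * α / 2)).toReal ≤ 1 / 3 + 3 * α.toReal / 2 := by
      refine (ENNReal.toReal_mono (ENNReal.add_ne_top.2 ⟨h13, h32⟩) (min_le_right _ _)).trans_eq ?_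
      rw [ENNReal.toReal_add h13 h32]
      simp
    linarith

end Exponents

end ThomasFermi

theorem mainTheorem6 (𝕜 : Type*) [RCLike 𝕜] (α : ℝ≥0∞) (hα : 0 < α) (δ : ℝ) (hδ : 0 < δ) :
    ∃ ε₀ ∈ Set.Ioo (0 : ℝ) 1, ∃ C : ℝ, 0 < C ∧ ∀ ε ∈ Set.Ioo (0 : ℝ) ε₀,
      ∃ Gminus Gplus D : ThomasFermi.L2 𝕜 →L[𝕜] ThomasFermi.L2 𝕜,
        ThomasFermi.IsBoundedInverse (ThomasFermi.Lminus 𝕜 ε) Gminus ∧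
        ThomasFermi.IsBoundedInverse (ThomasFermi.Lplus 𝕜 ε) Gplus ∧
        (∀ f, ThomasFermi.IsWeakDeriv (Gplus (Gminus f)) (D f)) ∧
        ThomasFermi.opNorm 2 (fun f => (D f : ℝ → 𝕜)) ≤
          ENNReal.ofReal (C * ε ^ (11 / 12 : ℝ)) ∧
        ThomasFermi.opNorm 2 (fun f => (Gplus (Gminus f) : ℝ → 𝕜)) ≤
          ENNReal.ofReal (C * ε ^ (26 / 15 - δ : ℝ)) ∧
        ThomasFermi.opNorm 2
            (fun f => {x : ℝ | 1 < |x|}.indicator (Gplus (Gminus f) : ℝ → 𝕜)) ≤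
          ENNReal.ofReal (C * ε ^ (7 / 3 - δ : ℝ)) ∧
        ThomasFermi.opNorm ⊤
            (fun f => (ThomasFermi.edgeSet ε α).indicator (D f : ℝ → 𝕜)) ≤
          ENNReal.ofReal (C * ε ^ ((min (4 / 3 : ℝ≥0∞) (1 / 3 + 3 * α / 2)).toReal - δ : ℝ)) ∧
        ThomasFermi.opNorm ⊤
            (fun f => (ThomasFermi.edgeSet ε α).indicator
              (Gplus (Gminus f) : ℝ → 𝕜)) ≤
          ENNReal.ofReal (C * ε ^ ((min (2 : ℝ≥0∞) (1 + 3 * α / 2)).toReal - δ : ℝ)) := by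
  refine ⟨1 / 2, by constructor <;> norm_num, 91000, by norm_num, fun ε hε => ?_⟩
  have hε0 : 0 < ε := hε.1
  have hε1 : ε ≤ 1 := by linarith [hε.2]
  have hexp : ∀ {a b : ℝ}, b ≤ a → ε ^ a ≤ ε ^ b := fun h =>
    Real.rpow_le_rpow_of_exponent_ge hε0 hε1 h
  obtain ⟨e, he_def⟩ : ∃ e, e = ε ^ (1 / 3 : ℝ) := ⟨_, rfl⟩
  have he : 0 < e := he_def ▸ Real.rpow_pos_of_pos hε0 _
  have he1 : e ≤ 1 := he_def ▸ Real.rpow_le_one hε0.le hε1 (by norm_num)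
  have hpow : ∀ n : ℕ, e ^ n = ε ^ ((n : ℝ) / 3) := fun n =>
    he_def ▸ ThomasFermi.rpow_third_pow hε0 n
  have he3 : e ^ 3 = ε := by
    rw [hpow]
    norm_num
  obtain ⟨Gm, Gp, D, hm, hp, hD, hDn, hw, hw', hDe⟩ :=
    ThomasFermi.exists_inverses_with_bounds (𝕜 := 𝕜) he he1
  rw [he3] at hm hp
  have hwB : ∀ f, ∀ᵐ x, 1 < |x| →
      ‖Gp (Gm f) x‖ ≤ 11000 * e ^ 6 * ‖f‖ / (1 + (x ^ 2 - 1) / e ^ 2) := fun f => by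
    filter_upwards [hw' f] with x hx h
    exact (hx h).trans_eq (by ring)
  have hL2 : ∀ f, eLpNorm (Gp (Gm f) : ℝ → 𝕜) 2 volume ≤
      ENNReal.ofReal (3 * (11000 * e ^ 6 * ‖f‖)) := fun f =>
    ThomasFermi.eLpNorm_two_le_of_edge_decay (by positivity) he he1 (hw f) (hwB f)
  have hL2n : ∀ f, ‖Gp (Gm f)‖ ≤ 3 * (11000 * e ^ 6 * ‖f‖) := fun f => by
    have h1 := hL2 f
    rw [← Lp.enorm_def, ← ofReal_norm, ENNReal.ofReal_le_ofReal_iff (by positivity)] at h1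
    exact h1
  refine ⟨Gm, Gp, D, hm, hp, hD, ?_, ?_, ?_, ?_, ?_⟩
  · refine (ThomasFermi.opNorm_le_of_forall (B := 400 * e ^ 3) (by positivity) fun f => ?_).trans
      (ENNReal.ofReal_le_ofReal ?_)
    · rw [← Lp.enorm_def, ← ofReal_norm]
      refine ENNReal.ofReal_le_ofReal (abs_le_of_sq_le_sq' ?_ (by positivity)).2
      have h1 : ‖Gp (Gm f)‖ * (4 * ‖f‖) ≤ 3 * (11000 * e ^ 6 * ‖f‖) * (4 * ‖f‖) := by
        gcongr
        exact hL2n f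
      have h2 : 0 ≤ e ^ 6 * ‖f‖ ^ 2 := by positivity
      nlinarith [hDn f]
    · have h1 : e ^ 3 ≤ ε ^ (11 / 12 : ℝ) := by
        rw [hpow]
        exact hexp (by norm_num)
      nlinarith [Real.rpow_pos_of_pos hε0 (11 / 12)]
  · refine (ThomasFermi.opNorm_le_of_forall (B := 33000 * e ^ 6) (by positivity) fun f =>
      (hL2 f).trans_eq (by ring_nf)).trans (ENNReal.ofReal_le_ofReal ?_)
    have h1 : e ^ 6 ≤ ε ^ (26 / 15 - δ) := by
      rw [hpow]
      refine hexp ?_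
      norm_num
      linarith
    nlinarith [Real.rpow_pos_of_pos hε0 (26 / 15 - δ)]
  · refine (ThomasFermi.opNorm_le_of_forall (B := 33000 * e ^ 7) (by positivity) fun f =>
      (ThomasFermi.eLpNorm_outer_le (by positivity) he (hwB f)).trans_eq (by ring_nf)).trans
      (ENNReal.ofReal_le_ofReal ?_)
    have h1 : e ^ 7 ≤ ε ^ (7 / 3 - δ) := by
      rw [hpow]
      refine hexp ?_
      norm_num
      linarith
    nlinarith [Real.rpow_pos_of_pos hε0 (7 / 3 - δ)]
  · have he2 : e ^ 2 = ε ^ (2 / 3 : ℝ) := by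
      rw [hpow]
      norm_num
    refine (ThomasFermi.opNorm_le_of_forall
      (B := 91000 * (e ^ 3 * √(max (ThomasFermi.extPow ε α) (e ^ 2))))
      (by positivity) fun f => ThomasFermi.eLpNorm_top_indicator_le (by positivity) ?_).trans
      (ENNReal.ofReal_le_ofReal ?_)
    · filter_upwards [hDe (max (ThomasFermi.extPow ε α) (e ^ 2)) (le_max_right _ _) f]
        with x hx hxS
      have hxS' : 1 - ThomasFermi.extPow ε α < |x| := hxS
      exact hx (by linarith [le_max_left (ThomasFermi.extPow ε α) (e ^ 2)])
    · gcongr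
      rw [he3, he2]
      exact (ThomasFermi.mul_sqrt_max_extPow_le hε0 hε1 α).trans (hexp (by linarith))
  · refine (ThomasFermi.opNorm_le_of_forall (B := 11000 * e ^ 6) (by positivity) fun f =>
      ThomasFermi.eLpNorm_top_indicator_le (by positivity) ((hw f).mono fun x hx _ => hx)).trans
      (ENNReal.ofReal_le_ofReal ?_)
    have h2 : (min (2 : ℝ≥0∞) (1 + 3 * α / 2)).toReal ≤ 2 :=
      (ENNReal.toReal_mono (by simp) (min_le_left _ _)).trans_eq (by simp)
    have h1 : e ^ 6 ≤ ε ^ ((min (2 : ℝ≥0∞) (1 + 3 * α / 2)).toReal - δ) := by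
      rw [hpow]
      refine hexp ?_
      norm_num
      linarith
    nlinarith [Real.rpow_pos_of_pos hε0 ((min (2 : ℝ≥0∞) (1 + 3 * α / 2)).toReal - δ)]
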